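/- For graphs $G$ (finite, simple, undirected, with at least one vertex) let $\alpha(G)$ be the independence number and $r(G)=\alpha(G)/|V(G)|$ the independence ratio. Let $G^k=G\times\cdots\times G$ be the $k$-fold categorical (tensor) product, in which two $k$-tuples of vertices are adjacent if and only if they are adjacent in $G$ in every coordinate. The tensor capacity of $G$ is $$\Theta^T(G)=\lim_{k\to\infty} r(G^k).$$ **Theorem.** There exists an algorithm that, given the adjacency matrix of an arbitrary graph $G$ with $n\ge 1$ vertices, computes $\Theta^T(G)$ exactly, as a fraction of two natural numbers (in particular $\Theta^T(G)$ is rational), in time $O^{\ast}(3^{n/3})$. That is, there is one fixed random access machine program and there are constants $C,d\in\mathbb N$ such that, for every $n\ge 1$ and every graph $G$ with $n$ vertices, the program halts on input $G$ with a numerator and a positive denominator of a fraction equal to $\Theta^T(G)$, at total logarithmic cost (each operation is charged according to the binary lengths of the numbers it handles) at most $C\,n^d\,3^{n/3}$. -/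

import Mathlib

/-! ### Tensor capacity -/

/-- The `k`-fold categorical (tensor) product `G × ⋯ × G`: two `k`-tuples are adjacent when they are
adjacent in every coordinate.  For `k ≥ 1` the clause `x ≠ y` follows from the other one; it
only keeps the empty product free of a loop. -/
def tensorPower {V : Type*} (G : SimpleGraph V) (k : ℕ) : SimpleGraph (Fin k → V) where
  Adj x y := x ≠ y ∧ ∀ i, G.Adj (x i) (y i)
  symm := ⟨fun _ _ h => ⟨h.1.symm, fun i => (h.2 i).symm⟩⟩
  loopless := ⟨fun _ h => h.1 rfl⟩

/-- The independence ratio `r(G) = α(G) / |V(G)|`. -/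
noncomputable def indepRatio {V : Type*} [Fintype V] (G : SimpleGraph V) : ℝ :=
  (G.indepNum : ℝ) / (Fintype.card V : ℝ)

/-- `θ` is the tensor capacity of `G`: the limit of `r(G ^ k)` for `k → ∞` exists and equals `θ`. -/
def HasTensorCapacity {V : Type*} [Fintype V] (G : SimpleGraph V) (θ : ℝ) : Prop :=
  Filter.Tendsto (fun k : ℕ => indepRatio (tensorPower G k)) Filter.atTop (nhds θ)

/-! ### Random access machine programs with the logarithmic cost measure -/

namespace RAM

/-- A memory: array number `k` has the natural number `m k i` in its cell `i`.  A program names its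
arrays literally, hence uses finitely many of them. -/
abbrev Mem : Type := ℕ → ℕ → ℕ

/-- Expressions; `get k e` reads the cell of array `k` whose index is the value of `e`
(indirect addressing). -/
inductive Expr : Type
  | const (c : ℕ)
  | get (k : ℕ) (e : Expr)
  | add (e₁ e₂ : Expr)
  | sub (e₁ e₂ : Expr)
  | mul (e₁ e₂ : Expr)

/-- Programs; `set k e₁ e₂` writes the value of `e₂` into the cell of array `k` whose index is
the value of `e₁`; a condition holds when its value is not zero. -/
inductive Prog : Type
  | skip
  | set (k : ℕ) (e₁ e₂ : Expr)
  | seq (P₁ P₂ : Prog)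
  | ite (e : Expr) (P₁ P₂ : Prog)
  | loop (e : Expr) (P : Prog)

/-- The cost of handling the number `x`: one more than its binary length. -/
def len (x : ℕ) : ℕ := Nat.size x + 1

/-- The value of an expression (`sub` is truncated subtraction). -/
def Expr.eval (m : Mem) : Expr → ℕ
  | .const c => c
  | .get k e => m k (e.eval m)
  | .add e₁ e₂ => e₁.eval m + e₂.eval m
  | .sub e₁ e₂ => e₁.eval m - e₂.eval m
  | .mul e₁ e₂ => e₁.eval m * e₂.eval m

/-- The logarithmic cost of evaluating an expression: access, addition and subtraction cost the
lengths of the numbers involved, multiplication costs the product of the lengths. -/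
def Expr.cost (m : Mem) : Expr → ℕ
  | .const c => len c
  | .get k e => e.cost m + len (e.eval m) + len (m k (e.eval m))
  | .add e₁ e₂ => e₁.cost m + e₂.cost m + len (e₁.eval m) + len (e₂.eval m)
  | .sub e₁ e₂ => e₁.cost m + e₂.cost m + len (e₁.eval m) + len (e₂.eval m)
  | .mul e₁ e₂ => e₁.cost m + e₂.cost m + len (e₁.eval m) * len (e₂.eval m)

/-- The memory `m` with cell `i` of array `k` overwritten by `x`. -/
def write (m : Mem) (k i x : ℕ) : Mem :=
  fun k' i' => if k' = k ∧ i' = i then x else m k' i'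

/-- `Runs P m t m'`: started in the memory `m`, the program `P` halts, at total cost `t`, in the
memory `m'`. -/
inductive Runs : Prog → Mem → ℕ → Mem → Prop
  | skip (m : Mem) : Runs .skip m 1 m
  | set (k : ℕ) (e₁ e₂ : Expr) (m : Mem) :
      Runs (.set k e₁ e₂) m (e₁.cost m + e₂.cost m + len (e₁.eval m) + len (e₂.eval m))
        (write m k (e₁.eval m) (e₂.eval m))
  | seq {P₁ P₂ : Prog} {m₀ m₁ m₂ : Mem} {t₁ t₂ : ℕ} :
      Runs P₁ m₀ t₁ m₁ → Runs P₂ m₁ t₂ m₂ → Runs (.seq P₁ P₂) m₀ (t₁ + t₂) m₂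
  | iteTrue {e : Expr} {P₁ P₂ : Prog} {m m' : Mem} {t : ℕ} :
      e.eval m ≠ 0 → Runs P₁ m t m' →
        Runs (.ite e P₁ P₂) m (e.cost m + len (e.eval m) + t) m'
  | iteFalse {e : Expr} {P₁ P₂ : Prog} {m m' : Mem} {t : ℕ} :
      e.eval m = 0 → Runs P₂ m t m' →
        Runs (.ite e P₁ P₂) m (e.cost m + len (e.eval m) + t) m'
  | loopStep {e : Expr} {P : Prog} {m₀ m₁ m₂ : Mem} {t₁ t₂ : ℕ} :
      e.eval m₀ ≠ 0 → Runs P m₀ t₁ m₁ → Runs (.loop e P) m₁ t₂ m₂ →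
        Runs (.loop e P) m₀ (e.cost m₀ + len (e.eval m₀) + t₁ + t₂) m₂
  | loopDone {e : Expr} {P : Prog} {m : Mem} :
      e.eval m = 0 → Runs (.loop e P) m (e.cost m + len (e.eval m)) m

open Classical in
/-- The initial memory for a graph on `{0, …, n - 1}`: the number `n` in cell `0` of array `0`, the
adjacency matrix, row by row, in array `1`, and zeros elsewhere. -/
noncomputable def input {n : ℕ} (G : SimpleGraph (Fin n)) : Mem := fun k c =>
  if k = 0 ∧ c = 0 then n
  else if k = 1 ∧ ∃ i j : Fin n, G.Adj i j ∧ c = (i : ℕ) * n + (j : ℕ) then 1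
  else 0

/-- The program `P` computes the tensor capacity of every graph with `n ≥ 1` vertices at cost at
most `T n`: it halts with a numerator in cell `0` and a positive denominator in cell `1` of
array `0`. -/
def ComputesTensorCapacity (P : Prog) (T : ℕ → ℝ) : Prop :=
  ∀ n : ℕ, 1 ≤ n → ∀ G : SimpleGraph (Fin n), ∃ (t : ℕ) (m : Mem),
    Runs P (input G) t m ∧ (t : ℝ) ≤ T n ∧ 0 < m 0 1 ∧
      HasTensorCapacity G ((m 0 0 : ℝ) / (m 0 1 : ℝ))

end RAM

/-- `T = O*(f)`: `T` is bounded by `f` up to a factor that is polynomial in `n`. -/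
def IsOStar (T f : ℕ → ℝ) : Prop :=
  ∃ C d : ℕ, ∀ n : ℕ, 1 ≤ n → T n ≤ (C : ℝ) * (n : ℝ) ^ d * f n

/-! Let A be an independent set that maximizes |A| / |N(A)|, and put a = |A|, b = |N(A)|. The
capacity is a / (a + b) if a ≤ b, and 1 if a > b.

Upper bound for a ≤ b: `Expands G a b` bounds the independence ratio by a / (a + b), because an
independent set is disjoint from its neighbourhood, and it is inherited by products
(`Expands.prod`). Lower bound: filling A × G^k completely and using an optimal set of G^k over the
vertices outside A ∪ N(A) gives r(G^(k+1)) ≥ a/n + (1 - (a+b)/n) r(G^k), an affine recursion with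
fixed point a / (a + b). If a > b, the tuples with more coordinates in A than in N(A) form an
independent set whose density tends to 1 by an exponential moment estimate
(`hasTensorCapacity_one`). An isolated vertex is the case N(A) = ∅.

It remains to maximize |A| / |N(A)|. Every independent set lies in a maximal one, and the maximal
ones are reached by branching on the closed neighbourhood of a vertex of minimum degree in the graph
still available. Such a branching of width k removes at least k vertices, and k ≤ 3^(k/3), whence
the bound 3^(n/3) (`passBound_step`).

Inside one maximal independent set I all subsets are treated at once. By Hall's theorem a bound q|A|
≤ p|N(A)| for all A ⊆ I yields an assignment of q units from each element of I to neighbours that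
receive at most p units each (`exists_assignment`). No flow is computed: in each of n^9 rounds every
element of I gives one unit to a nearly least loaded neighbour. The largest load over n^9 is at
least every ratio |A| / |N(A)|, and a quadratic potential shows that it stays below every fraction
with denominator at most n that exceeds these ratios (`IsLoad.succ`, `IsLoad.lt`). Hence the largest
fraction with small terms that the maximal load permits is exactly the optimum.

For the cost, all parts but one loop are bounded loops of polynomial cost. The passes of the
remaining loop are counted by a potential. A pass enlarges the numbers only by a polynomially
bounded summand, so even after exponentially many passes they have polynomial length. -/

namespace RAM

/-! ### Programs with bounded loops -/

/-- The cell `0` of array `k`, used as a scalar variable. -/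
abbrev rd (k : ℕ) : Expr := .get k (.const 0)

/-- Programs whose loops run a counter (cell `0` of an array) from `0` to the number in cell `0`
of array `0`. -/
inductive FProg : Type
  | skip
  | set (k : ℕ) (e₁ e₂ : Expr)
  | seq (P Q : FProg)
  | ite (e : Expr) (P Q : FProg)
  | loop (i : ℕ) (P : FProg)

namespace FProg

/-- The program with its bounded loops written as conditional loops. -/
def toProg : FProg → Prog
  | skip => .skip
  | set k e₁ e₂ => .set k e₁ e₂
  | seq P Q => .seq P.toProg Q.toProg
  | ite e P Q => .ite e P.toProg Q.toProg
  | loop i P => .seq (.set i (.const 0) (.const 0))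
      (.loop (.sub (rd 0) (rd i)) (.seq P.toProg (.set i (.const 0) (.add (rd i) (.const 1)))))

/-- The memory before pass `j` of a loop with counter `i` and body `F`, started in `m`. -/
def pass (F : Mem → Mem) (i : ℕ) (m : Mem) : ℕ → Mem
  | 0 => write m i 0 0
  | j + 1 => write (F (pass F i m j)) i 0 (j + 1)

/-- The final memory as a function of the initial one. -/
def den : FProg → Mem → Mem
  | skip, m => m
  | set k e₁ e₂, m => write m k (e₁.eval m) (e₂.eval m)
  | seq P Q, m => Q.den (P.den m)
  | ite e P Q, m => if e.eval m ≠ 0 then P.den m else Q.den m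
  | loop i P, m => pass P.den i m (m 0 0)

/-- The arrays a program writes. -/
def mods : FProg → List ℕ
  | skip => []
  | set k _ _ => [k]
  | seq P Q => P.mods ++ Q.mods
  | ite _ P Q => P.mods ++ Q.mods
  | loop i P => i :: P.mods

end FProg

/-- Expressions whose value exceeds the largest number in the memory by at most a constant. -/
def Expr.tame : Expr → Bool
  | .const _ => true
  | .get _ _ => true
  | .add e (.const _) => e.tame
  | .add _ _ => false
  | .sub e _ => e.tame
  | .mul _ _ => false

/-- Array `0` is not written, loop bodies do not write their counters, and written values are
tame. -/
def FProg.wf : FProg → Bool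
  | skip => true
  | set k _ e₂ => decide (k ≠ 0) && e₂.tame
  | seq P Q => P.wf && Q.wf
  | ite _ P Q => P.wf && Q.wf
  | loop i P => decide (i ≠ 0) && decide (i ∉ P.mods) && P.wf

/-- All numbers in the memory are at most `V`. -/
def Bdd (m : Mem) (V : ℕ) : Prop := ∀ k i, m k i ≤ V

theorem Bdd.mono {m : Mem} {V W : ℕ} (h : Bdd m V) (hVW : V ≤ W) : Bdd m W :=
  fun k i => (h k i).trans hVW

theorem Bdd.write {m : Mem} {V x : ℕ} (h : Bdd m V) (hx : x ≤ V) (k i : ℕ) :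
    Bdd (write m k i x) V := by
  intro k' i'
  unfold RAM.write
  split_ifs
  exacts [hx, h _ _]

@[simp] theorem write_same (m : Mem) (k i x : ℕ) : write m k i x k i = x := by simp [write]

theorem write_of_ne {k k' : ℕ} (h : k' ≠ k) (m : Mem) (i x : ℕ) : write m k i x k' = m k' := by
  funext j; simp [write, h]

theorem len_le {x L : ℕ} (h : x < 2 ^ L) : len x ≤ L + 1 :=
  Nat.succ_le_succ (Nat.size_le.2 h)

/-- The expression is fixed, so its size enters only through the constant a. A product adds lengths
and costs the product of two lengths of order L, hence the linear exponent and the square. -/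
theorem Expr.exists_bound (e : Expr) : ∃ a, ∀ m V L, 1 ≤ L → Bdd m V → V < 2 ^ L →
    e.eval m < 2 ^ (a * L) ∧ e.cost m ≤ a * L ^ 2 := by
  induction e with
  | const c =>
    refine ⟨c + 1, fun m V L hL _ _ => ⟨?_, ?_⟩⟩
    · exact (Nat.lt_two_pow_self (n := c)).trans_le
        (Nat.pow_le_pow_right (by norm_num) (by nlinarith))
    · have h1 : len c ≤ c + 1 := len_le Nat.lt_two_pow_self
      have h2 : 1 ≤ L ^ 2 := Nat.one_le_pow _ _ hL
      simp only [Expr.cost]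
      nlinarith
  | get k e ih =>
    obtain ⟨a, ha⟩ := ih
    refine ⟨2 * a + 3, fun m V L hL hm hV => ?_⟩
    obtain ⟨h1, h2⟩ := ha m V L hL hm hV
    have h3 : m k (e.eval m) < 2 ^ L := (hm _ _).trans_lt hV
    have h4 := len_le h1
    have h5 := len_le h3
    have hLL : L ≤ L ^ 2 := Nat.le_self_pow (by norm_num) L
    have haL : a * L ≤ a * L ^ 2 := Nat.mul_le_mul_left a hLL
    refine ⟨h3.trans_le (Nat.pow_le_pow_right (by norm_num) (by nlinarith)), ?_⟩
    simp only [Expr.cost]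
    nlinarith
  | add e₁ e₂ ih₁ ih₂ =>
    obtain ⟨a, ha⟩ := ih₁
    obtain ⟨b, hb⟩ := ih₂
    refine ⟨2 * a + 2 * b + 2, fun m V L hL hm hV => ?_⟩
    obtain ⟨h1, h2⟩ := ha m V L hL hm hV
    obtain ⟨h3, h4⟩ := hb m V L hL hm hV
    have h5 := len_le h1
    have h6 := len_le h3
    have hLL : L ≤ L ^ 2 := Nat.le_self_pow (by norm_num) L
    have haL : a * L ≤ a * L ^ 2 := Nat.mul_le_mul_left a hLL
    have hbL : b * L ≤ b * L ^ 2 := Nat.mul_le_mul_left b hLL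
    refine ⟨?_, ?_⟩
    · have h7 : 2 ^ (a * L) ≤ 2 ^ ((a + b) * L) :=
        Nat.pow_le_pow_right (by norm_num) (by nlinarith)
      have h8 : 2 ^ (b * L) ≤ 2 ^ ((a + b) * L) :=
        Nat.pow_le_pow_right (by norm_num) (by nlinarith)
      have h9 : 2 ^ ((a + b) * L + 1) ≤ 2 ^ ((2 * a + 2 * b + 2) * L) :=
        Nat.pow_le_pow_right (by norm_num) (by nlinarith)
      rw [pow_succ] at h9
      simp only [Expr.eval]
      omega
    · simp only [Expr.cost]
      nlinarith
  | sub e₁ e₂ ih₁ ih₂ =>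
    obtain ⟨a, ha⟩ := ih₁
    obtain ⟨b, hb⟩ := ih₂
    refine ⟨2 * a + 2 * b + 2, fun m V L hL hm hV => ?_⟩
    obtain ⟨h1, h2⟩ := ha m V L hL hm hV
    obtain ⟨h3, h4⟩ := hb m V L hL hm hV
    have h5 := len_le h1
    have h6 := len_le h3
    have hLL : L ≤ L ^ 2 := Nat.le_self_pow (by norm_num) L
    have haL : a * L ≤ a * L ^ 2 := Nat.mul_le_mul_left a hLL
    have hbL : b * L ≤ b * L ^ 2 := Nat.mul_le_mul_left b hLL
    refine ⟨?_, ?_⟩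
    · have h7 : 2 ^ (a * L) ≤ 2 ^ ((2 * a + 2 * b + 2) * L) :=
        Nat.pow_le_pow_right (by norm_num) (by nlinarith)
      simp only [Expr.eval]
      omega
    · simp only [Expr.cost]
      nlinarith
  | mul e₁ e₂ ih₁ ih₂ =>
    obtain ⟨a, ha⟩ := ih₁
    obtain ⟨b, hb⟩ := ih₂
    refine ⟨a + b + (a + 1) * (b + 1), fun m V L hL hm hV => ?_⟩
    obtain ⟨h1, h2⟩ := ha m V L hL hm hV
    obtain ⟨h3, h4⟩ := hb m V L hL hm hV
    refine ⟨?_, ?_⟩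
    · have h7 : e₁.eval m * e₂.eval m < 2 ^ (a * L) * 2 ^ (b * L) := Nat.mul_lt_mul'' h1 h3
      rw [← pow_add] at h7
      exact h7.trans_le (Nat.pow_le_pow_right (by norm_num) (by nlinarith))
    · have h5 : len (e₁.eval m) ≤ (a + 1) * L := (len_le h1).trans (by nlinarith)
      have h6 : len (e₂.eval m) ≤ (b + 1) * L := (len_le h3).trans (by nlinarith)
      have h7 := Nat.mul_le_mul h5 h6
      simp only [Expr.cost]
      nlinarith

theorem Expr.exists_eval_le {e : Expr} (h : e.tame = true) :
    ∃ a, ∀ m V, Bdd m V → e.eval m ≤ V + a := by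
  induction e with
  | const c => exact ⟨c, fun m V _ => Nat.le_add_left _ _⟩
  | get k e _ => exact ⟨0, fun m V hm => hm _ _⟩
  | add e₁ e₂ ih₁ _ =>
    cases e₂ with
    | const c =>
      obtain ⟨a, ha⟩ := ih₁ h
      refine ⟨a + c, fun m V hm => ?_⟩
      have := ha m V hm
      simp only [Expr.eval]
      omega
    | _ => simp [Expr.tame] at h
  | sub e₁ e₂ ih₁ _ =>
    obtain ⟨a, ha⟩ := ih₁ h
    exact ⟨a, fun m V hm => (Nat.sub_le _ _).trans (ha m V hm)⟩
  | mul e₁ e₂ _ _ => simp [Expr.tame] at h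

/-- Polynomially bounded functions. -/
def PolyBdd (K : ℕ → ℕ) : Prop := ∃ a d : ℕ, ∀ n, K n ≤ a * (n + 1) ^ d

theorem PolyBdd.const (c : ℕ) : PolyBdd fun _ => c := ⟨c, 0, fun n => by simp⟩

theorem PolyBdd.id : PolyBdd fun n => n := ⟨1, 1, fun n => by simp⟩

theorem PolyBdd.add {K K' : ℕ → ℕ} (h : PolyBdd K) (h' : PolyBdd K') :
    PolyBdd fun n => K n + K' n := by
  obtain ⟨a, d, h⟩ := h
  obtain ⟨a', d', h'⟩ := h'
  refine ⟨a + a', d + d', fun n => ?_⟩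
  have h1 : (n + 1) ^ d ≤ (n + 1) ^ (d + d') := Nat.pow_le_pow_right (by omega) (by omega)
  have h2 : (n + 1) ^ d' ≤ (n + 1) ^ (d + d') := Nat.pow_le_pow_right (by omega) (by omega)
  rw [add_mul]
  exact add_le_add ((h n).trans (Nat.mul_le_mul_left _ h1))
    ((h' n).trans (Nat.mul_le_mul_left _ h2))

theorem PolyBdd.mul {K K' : ℕ → ℕ} (h : PolyBdd K) (h' : PolyBdd K') :
    PolyBdd fun n => K n * K' n := by
  obtain ⟨a, d, h⟩ := h
  obtain ⟨a', d', h'⟩ := h'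
  refine ⟨a * a', d + d', fun n => (Nat.mul_le_mul (h n) (h' n)).trans_eq ?_⟩
  rw [pow_add]; ring

/-! ### Frame rule, loop invariants and cost of bounded loops -/

namespace FProg

theorem pass_apply {F : Mem → Mem} {i k : ℕ} (hk : k ≠ i) (hF : ∀ m, F m k = m k) (m : Mem)
    (j : ℕ) : pass F i m j k = m k := by
  induction j with
  | zero => exact write_of_ne hk _ _ _
  | succ j ih => rw [pass, write_of_ne hk, hF, ih]

/-- The frame rule: it carries the input, the stack and the current set past subprograms that do not
touch them. -/
theorem den_apply {P : FProg} {k : ℕ} (hk : k ∉ P.mods) (m : Mem) : P.den m k = m k := by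
  induction P generalizing m with
  | skip => rfl
  | set k' e₁ e₂ =>
    simp only [mods, List.mem_singleton] at hk
    exact write_of_ne hk _ _ _
  | seq P Q ihP ihQ =>
    simp only [mods, List.mem_append, not_or] at hk
    simp only [den]
    rw [ihQ hk.2, ihP hk.1]
  | ite e P Q ihP ihQ =>
    simp only [mods, List.mem_append, not_or] at hk
    simp only [den]
    split_ifs
    exacts [ihP hk.1 m, ihQ hk.2 m]
  | loop i P ih =>
    simp only [mods, List.mem_cons, not_or] at hk
    exact pass_apply hk.1 (ih hk.2) m _

theorem zero_notMem_mods {P : FProg} (h : P.wf = true) : 0 ∉ P.mods := by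
  induction P with
  | skip => simp [mods]
  | set k e₁ e₂ => simp [wf] at h; simp [mods]; omega
  | seq P Q ihP ihQ => simp [wf] at h; simp [mods, ihP h.1, ihQ h.2]
  | ite e P Q ihP ihQ => simp [wf] at h; simp [mods, ihP h.1, ihQ h.2]
  | loop i P ih => simp [wf] at h; simp [mods, ih h.2]; omega

theorem den_zero {P : FProg} (h : P.wf = true) (m : Mem) : P.den m 0 = m 0 :=
  den_apply (zero_notMem_mods h) m

theorem pass_counter (F : Mem → Mem) (i : ℕ) (m : Mem) (j : ℕ) : pass F i m j i 0 = j := by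
  cases j <;> exact write_same _ _ _ _

/-- The invariant rule for bounded loops. -/
theorem den_loop {i : ℕ} {P : FProg} {m : Mem}
    (Inv : ℕ → Mem → Prop) (h0 : Inv 0 (write m i 0 0))
    (hs : ∀ j < m 0 0, ∀ m', (∀ k ∉ (loop i P).mods, m' k = m k) → m' i 0 = j → Inv j m' →
      Inv (j + 1) (write (P.den m') i 0 (j + 1))) :
    Inv (m 0 0) ((loop i P).den m) := by
  suffices H : ∀ j ≤ m 0 0, Inv j (pass P.den i m j) from H _ le_rfl
  intro j
  induction j with
  | zero => exact fun _ => h0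
  | succ j ih =>
    intro hj
    refine hs j hj _ (fun k hk => ?_) (pass_counter _ _ _ _) (ih (by omega))
    simp only [mods, List.mem_cons, not_or] at hk
    exact pass_apply hk.1 (den_apply hk.2) m j

/-- The cost of `P`, and the growth of the numbers in the memory, are polynomially bounded. -/
theorem exists_cost {P : FProg} (h : P.wf = true) : ∃ K, PolyBdd K ∧ ∀ m V L, 1 ≤ L → Bdd m V →
    V + K (m 0 0) < 2 ^ L → ∃ t, Runs P.toProg m t (P.den m) ∧ t ≤ K (m 0 0) * L ^ 2 ∧
      Bdd (P.den m) (V + K (m 0 0)) := by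
  induction P with
  | skip =>
    refine ⟨_, .const 1, fun m V L hL hm _ => ⟨1, .skip m, ?_, hm.mono (by omega)⟩⟩
    simpa using Nat.one_le_pow _ _ hL
  | set k e₁ e₂ =>
    simp only [wf, Bool.and_eq_true] at h
    obtain ⟨a, ha⟩ := e₁.exists_bound
    obtain ⟨b, hb⟩ := e₂.exists_bound
    obtain ⟨c, hc⟩ := Expr.exists_eval_le h.2
    refine ⟨_, .const (2 * a + 2 * b + 2 + c), fun m V L hL hm hV => ⟨_, .set k e₁ e₂ m, ?_, ?_⟩⟩
    · obtain ⟨h1, h2⟩ := ha m V L hL hm (by omega)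
      obtain ⟨h3, h4⟩ := hb m V L hL hm (by omega)
      have h5 := len_le h1
      have h6 := len_le h3
      have hLL : L ≤ L ^ 2 := Nat.le_self_pow (by norm_num) L
      have haL : a * L ≤ a * L ^ 2 := Nat.mul_le_mul_left a hLL
      have hbL : b * L ≤ b * L ^ 2 := Nat.mul_le_mul_left b hLL
      nlinarith
    · exact (hm.mono (by omega)).write ((hc m V hm).trans (by omega)) _ _
  | seq P Q ihP ihQ =>
    simp only [wf, Bool.and_eq_true] at h
    obtain ⟨K, hK, HK⟩ := ihP h.1
    obtain ⟨K', hK', HK'⟩ := ihQ h.2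
    refine ⟨_, hK.add hK', fun m V L hL hm hV => ?_⟩
    obtain ⟨t, h1, h2, h3⟩ := HK m V L hL hm (by omega)
    have h0 : P.den m 0 0 = m 0 0 := by rw [den_zero h.1]
    obtain ⟨t', h4, h5, h6⟩ := HK' (P.den m) _ L hL h3 (by rw [h0]; omega)
    rw [h0] at h5 h6
    refine ⟨t + t', .seq h1 h4, ?_, h6.mono (by omega)⟩
    rw [add_mul]
    omega
  | ite e P Q ihP ihQ =>
    simp only [wf, Bool.and_eq_true] at h
    obtain ⟨K, hK, HK⟩ := ihP h.1
    obtain ⟨K', hK', HK'⟩ := ihQ h.2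
    obtain ⟨a, ha⟩ := e.exists_bound
    refine ⟨_, (hK.add hK').add (.const (2 * a + 1)), fun m V L hL hm hV => ?_⟩
    obtain ⟨h7, h8⟩ := ha m V L hL hm (by omega)
    have h9 := len_le h7
    have hLL : L ≤ L ^ 2 := Nat.le_self_pow (by norm_num) L
    have haL : a * L ≤ a * L ^ 2 := Nat.mul_le_mul_left a hLL
    by_cases he : e.eval m = 0
    · obtain ⟨t, h1, h2, h3⟩ := HK' m V L hL hm (by omega)
      simp only [den, he, ne_eq, not_true_eq_false, if_false, toProg]
      refine ⟨_, .iteFalse he h1, ?_, h3.mono (by omega)⟩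
      have : 0 ≤ K (m 0 0) * L ^ 2 := Nat.zero_le _
      nlinarith
    · obtain ⟨t, h1, h2, h3⟩ := HK m V L hL hm (by omega)
      simp only [den, ne_eq, he, not_false_eq_true, if_true, toProg]
      refine ⟨_, .iteTrue he h1, ?_, h3.mono (by omega)⟩
      have : 0 ≤ K' (m 0 0) * L ^ 2 := Nat.zero_le _
      nlinarith
  | loop i P ih =>
    simp only [wf, Bool.and_eq_true, decide_eq_true_eq] at h
    obtain ⟨⟨hi, hiP⟩, hP⟩ := h
    obtain ⟨K, hK, HK⟩ := ih hP
    obtain ⟨a, ha⟩ := (Expr.sub (rd 0) (rd i)).exists_bound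
    obtain ⟨b, hb⟩ := (Expr.add (rd i) (.const 1)).exists_bound
    refine ⟨_, (PolyBdd.id.mul (hK.add (.const (2 * a + 2 * b + 8)))).add
      (.const (2 * a + 20)), fun m V L hL hm hV => ?_⟩
    set n := m 0 0 with hn
    set c := K n + (2 * a + 2 * b + 8) with hc
    have hLL : L ≤ L ^ 2 := Nat.le_self_pow (by norm_num) L
    have haL : a * L ≤ a * L ^ 2 := Nat.mul_le_mul_left a hLL
    have hbL : b * L ≤ b * L ^ 2 := Nat.mul_le_mul_left b hLL
    have hp0 : ∀ j, pass P.den i m j 0 0 = n := fun j => by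
      rw [pass_apply hi.symm (den_zero hP)]
    -- Induction on the number r of passes left. Each pass raises the bound W by c, and n ≤ W keeps
    -- the counter itself below the bound.
    have key : ∀ r j W, j + r = n → Bdd (pass P.den i m j) W → n ≤ W → W + r * c < 2 ^ L →
        ∃ t, Runs (.loop (.sub (rd 0) (rd i))
          (.seq P.toProg (.set i (.const 0) (.add (rd i) (.const 1)))))
          (pass P.den i m j) t (pass P.den i m n) ∧ t ≤ (r * c + (2 * a + 1)) * L ^ 2 ∧
          Bdd (pass P.den i m n) (W + r * c) := by
      intro r
      induction r with
      | zero =>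
        intro j W hj hW _ hWL
        obtain rfl : j = n := by omega
        obtain ⟨h1, h2⟩ := ha _ W L hL hW (by omega)
        refine ⟨_, .loopDone ?_, ?_, hW.mono (by omega)⟩
        · simp [Expr.eval, hp0, pass_counter]
        · have := len_le h1
          nlinarith
      | succ r ihr =>
        intro j W hj hW hnW hWL
        rw [add_mul, one_mul] at hWL
        obtain ⟨h1, h2⟩ := ha _ W L hL hW (by omega)
        have h1' := len_le h1
        obtain ⟨t, h3, h4, h5⟩ := HK (pass P.den i m j) W L hL hW (by rw [hp0]; omega)
        rw [hp0] at h4 h5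
        obtain ⟨h6, h7⟩ := hb _ _ L hL h5 (by omega)
        have h6' := len_le h6
        have h8 := Runs.set i (.const 0) (.add (rd i) (.const 1)) (P.den (pass P.den i m j))
        have hx : P.den (pass P.den i m j) i 0 = j := by rw [den_apply hiP, pass_counter]
        have h9 : write (P.den (pass P.den i m j)) i (Expr.eval (P.den (pass P.den i m j)) (.const 0))
            (Expr.eval (P.den (pass P.den i m j)) (.add (rd i) (.const 1))) =
            pass P.den i m (j + 1) := by
          simp [Expr.eval, hx, pass]
        rw [h9] at h8
        obtain ⟨t', h10, h11, h12⟩ := ihr (j + 1) (W + c) (by omega)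
          ((h5.mono (by omega)).write (by omega) _ _) (by omega) (by omega)
        refine ⟨_, .loopStep ?_ (.seq h3 h8) h10, ?_, h12.mono ?_⟩
        · simp [Expr.eval, hp0, pass_counter]
          omega
        · have e1 : Expr.cost (P.den (pass P.den i m j)) (.const 0) = 1 := rfl
          have e2 : len (Expr.eval (P.den (pass P.den i m j)) (.const 0)) = 1 := rfl
          rw [e1, e2]
          have : 1 ≤ L ^ 2 := Nat.one_le_pow _ _ hL
          have e3 : ((r + 1) * c + (2 * a + 1)) * L ^ 2 =
            (r * c + (2 * a + 1)) * L ^ 2 + (K n * L ^ 2 + 2 * (a * L ^ 2) + 2 * (b * L ^ 2) +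
              8 * L ^ 2) := by rw [hc]; ring
          rw [e3]
          omega
        · rw [add_mul, one_mul]; omega
    have hw : Bdd (pass P.den i m 0) V := hm.write (Nat.zero_le _) _ _
    have h1 := Runs.set i (.const 0) (.const 0) m
    obtain ⟨t, h2, h3, h4⟩ := key n 0 V (by omega) hw (hm 0 0) (by omega)
    refine ⟨_, .seq h1 h2, ?_, h4.mono (by omega)⟩
    have e1 : Expr.cost m (.const 0) = 1 := rfl
    have e2 : len (Expr.eval m (.const 0)) = 1 := rfl
    rw [e1, e2]
    have h5 : 1 ≤ L ^ 2 := Nat.one_le_pow _ _ hL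
    have e3 : (n * c + (2 * a + 20)) * L ^ 2 = (n * c + (2 * a + 1)) * L ^ 2 + 19 * L ^ 2 := by ring
    rw [e3]
    omega

end FProg

/-- A loop whose body is a program with bounded loops, with a potential function that bounds the
number of passes. -/
theorem exists_runs_loop {P : FProg} (hP : P.wf = true) (e : Expr) : ∃ K, PolyBdd K ∧
    ∀ (Inv : Mem → Prop) (Φ : Mem → ℝ), (∀ m, 0 ≤ Φ m) →
    (∀ m, Inv m → e.eval m ≠ 0 → Inv (P.den m) ∧ Φ (P.den m) + 1 ≤ Φ m) →
    ∀ (N : ℕ) (m : Mem) (V L : ℕ), Inv m → Φ m ≤ N → 1 ≤ L → Bdd m V →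
      V + N * K (m 0 0) < 2 ^ L → ∃ t m', Runs (.loop e P.toProg) m t m' ∧ Inv m' ∧
        e.eval m' = 0 ∧ t ≤ (N + 1) * K (m 0 0) * L ^ 2 ∧ Bdd m' (V + N * K (m 0 0)) ∧
          m' 0 0 = m 0 0 := by
  obtain ⟨K, hK, HK⟩ := FProg.exists_cost hP
  obtain ⟨a, ha⟩ := e.exists_bound
  refine ⟨_, hK.add (.const (2 * a + 1)), fun Inv Φ hΦ hs N => ?_⟩
  induction N with
  | zero =>
    intro m V L hI hN hL hm hV
    have he : e.eval m = 0 := by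
      -- With potential at most 0, one more pass would make the potential negative.
      by_contra he
      have h1 := (hs m hI he).2
      have h2 := hΦ (P.den m)
      push_cast at hN
      linarith
    obtain ⟨h1, h2⟩ := ha _ V L hL hm (by omega)
    refine ⟨_, m, .loopDone he, hI, he, ?_, hm.mono (by omega), rfl⟩
    have := len_le h1
    have hLL : L ≤ L ^ 2 := Nat.le_self_pow (by norm_num) L
    have haL : a * L ≤ a * L ^ 2 := Nat.mul_le_mul_left a hLL
    have : 0 ≤ K (m 0 0) * L ^ 2 := Nat.zero_le _
    nlinarith
  | succ N ih =>
    intro m V L hI hN hL hm hV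
    rw [add_mul, one_mul] at hV
    obtain ⟨h1, h2⟩ := ha _ V L hL hm (by omega)
    have h1' := len_le h1
    have hLL : L ≤ L ^ 2 := Nat.le_self_pow (by norm_num) L
    have haL : a * L ≤ a * L ^ 2 := Nat.mul_le_mul_left a hLL
    have e3 : (N + 1 + 1) * (K (m 0 0) + (2 * a + 1)) * L ^ 2 =
      (N + 1) * (K (m 0 0) + (2 * a + 1)) * L ^ 2 +
        (K (m 0 0) * L ^ 2 + 2 * (a * L ^ 2) + L ^ 2) := by ring
    by_cases he : e.eval m = 0
    · refine ⟨_, m, .loopDone he, hI, he, ?_, hm.mono (by omega), rfl⟩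
      rw [e3]
      have : 0 < L ^ 2 := by positivity
      omega
    · obtain ⟨hI', hΦ'⟩ := hs m hI he
      obtain ⟨t, h3, h4, h5⟩ := HK m V L hL hm (by omega)
      have h0 : P.den m 0 0 = m 0 0 := by rw [FProg.den_zero hP]
      push_cast at hN
      obtain ⟨t', m', h6, h7, h8, h9, h10, h11⟩ := ih (P.den m)
        (V + (K (m 0 0) + (2 * a + 1))) L hI' (by linarith) hL (h5.mono (by omega))
        (by rw [h0]; omega)
      rw [h0] at h9 h10 h11
      refine ⟨_, m', .loopStep he h3 h6, h7, h8, ?_, h10.mono ?_, h11⟩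
      · rw [e3]
        omega
      · rw [add_mul, one_mul]; omega

end RAM

/-! ### The value of the capacity: expansion of independent sets -/

open Finset in
/-- The set of neighbours of the elements of `A`. -/
noncomputable def nbr {V : Type*} [Fintype V] (G : SimpleGraph V) (A : Finset V) : Finset V := by
  classical exact univ.filter fun x => ∃ a ∈ A, G.Adj a x

/-- Independent sets `A` satisfy `b |A| ≤ a |N(A)|`. -/
def Expands {V : Type*} [Fintype V] (G : SimpleGraph V) (a b : ℕ) : Prop :=
  ∀ A : Finset V, G.IsIndepSet (A : Set V) → b * A.card ≤ a * (nbr G A).card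

section Capacity

open Finset

theorem isIndepSet_iff {V : Type*} {G : SimpleGraph V} {A : Finset V} :
    G.IsIndepSet (A : Set V) ↔ ∀ x ∈ A, ∀ y ∈ A, ¬ G.Adj x y := by
  constructor
  · exact fun h x hx y hy hxy => h hx hy hxy.ne hxy
  · exact fun h x hx y hy _ => h x hx y hy

theorem tensorPower_succ_adj {V : Type*} (G : SimpleGraph V) (k : ℕ) (x y : Fin (k + 1) → V) :
    (tensorPower G (k + 1)).Adj x y ↔ ∀ i, G.Adj (x i) (y i) :=
  ⟨fun h => h.2, fun h => ⟨fun hxy => (h 0).ne (congrFun hxy 0), h⟩⟩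

theorem tensorPower_cons_adj {V : Type*} (G : SimpleGraph V) (k : ℕ) (x y : V × (Fin (k + 1) → V)) :
    (tensorPower G (k + 2)).Adj (Fin.consEquiv (fun _ => V) x) (Fin.consEquiv (fun _ => V) y) ↔
      G.Adj x.1 y.1 ∧ (tensorPower G (k + 1)).Adj x.2 y.2 := by
  rw [tensorPower_succ_adj, tensorPower_succ_adj, Fin.forall_fin_succ]
  simp [Fin.consEquiv]

variable {V W : Type*} [Fintype V] [Fintype W]

theorem mem_nbr {G : SimpleGraph V} {A : Finset V} {x : V} :
    x ∈ nbr G A ↔ ∃ a ∈ A, G.Adj a x := by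
  simp [nbr]

theorem disjoint_nbr {G : SimpleGraph V} {A : Finset V} (hA : G.IsIndepSet (A : Set V)) :
    Disjoint A (nbr G A) := by
  rw [Finset.disjoint_left]
  rintro x hx hx'
  obtain ⟨a, ha, hax⟩ := mem_nbr.1 hx'
  exact isIndepSet_iff.1 hA a ha x hx hax

theorem nbr_mono {G : SimpleGraph V} {A B : Finset V} (h : A ⊆ B) : nbr G A ⊆ nbr G B := by
  intro x hx
  obtain ⟨a, ha, hax⟩ := mem_nbr.1 hx
  exact mem_nbr.2 ⟨a, h ha, hax⟩

/-- Remove from S = B ∪ E the vertices with a neighbour in S. The rest I is independent and contains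
B, and N(I) and the removed part are disjoint subsets of N(S). So a|N(S)| ≥ b|I| + a(|S| - |I|) =
a|S| + (b - a)|I|, and a ≤ b allows |I| to be replaced by |B|. -/
theorem Expands.union [DecidableEq V] {G : SimpleGraph V} {a b : ℕ} (hG : Expands G a b)
    (hab : a ≤ b) {B E : Finset V} (hBE : Disjoint B E)
    (hB : ∀ x ∈ B, ∀ y ∈ B ∪ E, ¬ G.Adj x y) :
    b * B.card + a * E.card ≤ a * (nbr G (B ∪ E)).card := by
  set S := B ∪ E with hS
  set I := S.filter (· ∉ nbr G S) with hI
  have hIi : G.IsIndepSet (I : Set V) := by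
    rw [isIndepSet_iff]
    intro x hx y hy hxy
    rw [hI, mem_filter] at hx hy
    exact hy.2 (mem_nbr.2 ⟨x, hx.1, hxy⟩)
  have h1 := hG I hIi
  have h2 : (nbr G I).card + (S.filter (· ∈ nbr G S)).card ≤ (nbr G S).card := by
    rw [← card_union_of_disjoint]
    · refine card_le_card (union_subset (nbr_mono (filter_subset _ _)) ?_)
      exact fun x hx => (mem_filter.1 hx).2
    · rw [Finset.disjoint_left]
      intro x hx hx'
      obtain ⟨y, hy, hyx⟩ := mem_nbr.1 hx
      exact (mem_filter.1 hy).2 (mem_nbr.2 ⟨x, (mem_filter.1 hx').1, hyx.symm⟩)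
  have h3 : (S.filter (· ∈ nbr G S)).card + I.card = S.card := by
    rw [hI, card_filter_add_card_filter_not]
  have h4 : S.card = B.card + E.card := card_union_of_disjoint hBE
  have h5 : B.card ≤ I.card := by
    refine card_le_card fun x hx => mem_filter.2 ⟨mem_union_left _ hx, fun hx' => ?_⟩
    obtain ⟨y, hy, hyx⟩ := mem_nbr.1 hx'
    exact hB x hx y hy hyx.symm
  obtain ⟨c, rfl⟩ := Nat.exists_eq_add_of_le hab
  have h6 := Nat.mul_le_mul_left c h5
  have h7 := Nat.mul_le_mul_left a h2
  have h8 : a * (B.card + E.card) = a * ((S.filter (· ∈ nbr G S)).card + I.card) := by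
    rw [h3, h4]
  nlinarith

theorem card_eq_sum_card_left (A : Finset (V × W)) [DecidableEq V] [DecidableEq W] :
    A.card = ∑ x, (univ.filter fun y => (x, y) ∈ A).card := by
  simp_rw [card_filter]
  rw [← Fintype.sum_prod_type' (f := fun x y => if (x, y) ∈ A then 1 else 0)]
  simp

theorem card_eq_sum_card_right (A : Finset (V × W)) [DecidableEq V] [DecidableEq W] :
    A.card = ∑ y, (univ.filter fun x => (x, y) ∈ A).card := by
  simp_rw [card_filter]
  rw [← Fintype.sum_prod_type_right' (f := fun x y => if (x, y) ∈ A then 1 else 0)]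
  simp

/-- Expansion is preserved by categorical products. -/
theorem Expands.prod {G : SimpleGraph V} {H : SimpleGraph W} {K : SimpleGraph (V × W)}
    (hK : ∀ x y, K.Adj x y ↔ G.Adj x.1 y.1 ∧ H.Adj x.2 y.2) {a b : ℕ} (hab : a ≤ b)
    (hG : Expands G a b) (hH : Expands H a b) : Expands K a b := by
  classical
  intro A hA
  rw [isIndepSet_iff] at hA
  -- B holds the points with a neighbour in their own fibre {x} × W, and C the rest, so each fibre
  -- of C is independent in H and expands into the fibre of E. In direction V no point of B is
  -- adjacent to B ∪ E on the same level y, so `Expands.union` applies there. In the sum over all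
  -- fibres E cancels, leaving b|B| + b|C| ≤ a|N(A)|.
  set B := A.filter fun p => ∃ y, (p.1, y) ∈ A ∧ H.Adj p.2 y with hB
  set C := A.filter fun p => ¬ ∃ y, (p.1, y) ∈ A ∧ H.Adj p.2 y with hC
  set E : Finset (V × W) := univ.filter fun p => ∃ y, (p.1, y) ∈ C ∧ H.Adj y p.2 with hE
  have hBC : B.card + C.card = A.card := card_filter_add_card_filter_not _
  have h1 : ∀ y, b * (univ.filter fun x => (x, y) ∈ B).card +
      a * (univ.filter fun x => (x, y) ∈ E).card ≤
      a * (univ.filter fun x => (x, y) ∈ nbr K A).card := by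
    intro y
    refine (hG.union hab ?_ ?_).trans (Nat.mul_le_mul_left a (card_le_card ?_))
    · rw [Finset.disjoint_left]
      intro x hx hx'
      simp only [hB, hC, hE, mem_filter, mem_univ, true_and] at hx hx'
      obtain ⟨y', ⟨h2, h3⟩, h4⟩ := hx'
      exact h3 ⟨y, hx.1, h4⟩
    · intro x hx x' hx' hxx
      simp only [hB, hC, hE, mem_filter, mem_univ, true_and, mem_union] at hx hx'
      obtain ⟨h2, y', h3, h4⟩ := hx
      rcases hx' with ⟨h5, -⟩ | ⟨y'', ⟨h5, -⟩, h6⟩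
      · exact hA _ h3 _ h5 ((hK _ _).2 ⟨hxx, h4.symm⟩)
      · exact hA _ h2 _ h5 ((hK _ _).2 ⟨hxx, h6.symm⟩)
    · intro x hx
      obtain ⟨x', hx', hxx⟩ := mem_nbr.1 hx
      simp only [hB, hC, hE, mem_filter, mem_univ, true_and, mem_union] at hx'
      refine mem_filter.2 ⟨mem_univ _, mem_nbr.2 ?_⟩
      rcases hx' with ⟨-, y', h3, h4⟩ | ⟨y'', ⟨h5, -⟩, h6⟩
      · exact ⟨_, h3, (hK _ _).2 ⟨hxx, h4.symm⟩⟩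
      · exact ⟨_, h5, (hK _ _).2 ⟨hxx, h6⟩⟩
  have h2 : ∀ x, b * (univ.filter fun y => (x, y) ∈ C).card ≤
      a * (univ.filter fun y => (x, y) ∈ E).card := by
    intro x
    refine (hH _ ?_).trans (Nat.mul_le_mul_left a (card_le_card ?_))
    · rw [isIndepSet_iff]
      intro y hy y' hy' hyy
      simp only [hC, mem_filter, mem_univ, true_and] at hy hy'
      exact hy.2 ⟨y', hy'.1, hyy⟩
    · intro y hy
      obtain ⟨y', hy', hyy⟩ := mem_nbr.1 hy
      exact mem_filter.2 ⟨mem_univ _, mem_filter.2 ⟨mem_univ _, y', (mem_filter.1 hy').2, hyy⟩⟩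
  have h3 := sum_le_sum fun y (_ : y ∈ univ) => h1 y
  have h4 := sum_le_sum fun x (_ : x ∈ univ) => h2 x
  rw [sum_add_distrib, ← mul_sum, ← mul_sum, ← mul_sum, ← card_eq_sum_card_right,
    ← card_eq_sum_card_right, ← card_eq_sum_card_right] at h3
  rw [← mul_sum, ← mul_sum, ← card_eq_sum_card_left, ← card_eq_sum_card_left] at h4
  rw [← hBC, mul_add]
  omega

theorem Expands.of_equiv {G : SimpleGraph V} {H : SimpleGraph W} (e : W ≃ V)
    (he : ∀ x y, H.Adj x y ↔ G.Adj (e x) (e y)) {a b : ℕ} (hG : Expands G a b) :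
    Expands H a b := by
  intro A hA
  have h1 := hG (A.map e.toEmbedding) (by
    rw [isIndepSet_iff] at hA ⊢
    simp only [mem_map, forall_exists_index, and_imp, forall_apply_eq_imp_iff₂]
    intro x hx y hy hxy
    exact hA x hx y hy ((he x y).2 hxy))
  rw [card_map] at h1
  refine h1.trans (Nat.mul_le_mul_left a ?_)
  rw [← card_map e.toEmbedding (s := nbr H A)]
  refine card_le_card fun x hx => ?_
  obtain ⟨y, hy, hyx⟩ := mem_nbr.1 hx
  obtain ⟨z, hz, rfl⟩ := mem_map.1 hy
  refine mem_map.2 ⟨e.symm x, mem_nbr.2 ⟨z, hz, (he _ _).2 (by simpa using hyx)⟩, by simp⟩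

/-- The exponents start at 1 because the empty power is a single isolated vertex, which does not
expand when b > 0. -/
theorem Expands.tensorPower {G : SimpleGraph V} {a b : ℕ} (hab : a ≤ b) (hG : Expands G a b)
    (k : ℕ) : Expands (tensorPower G (k + 1)) a b := by
  induction k with
  | zero =>
    refine hG.of_equiv (Equiv.funUnique (Fin 1) V) fun x y => ?_
    rw [tensorPower_succ_adj]
    simp
  | succ k ih =>
    set e := Fin.consEquiv (n := k + 1) (fun _ => V)
    have h := hG.prod (K := (_root_.tensorPower G (k + 2)).comap e)
      (tensorPower_cons_adj G k) hab ih
    exact h.of_equiv e.symm fun x y => by simp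

/-- A maximum independent set and its neighbourhood are disjoint, so (a + b)|A| ≤ a(|A| + |N(A)|) ≤
a|V|. -/
theorem Expands.indepRatio_le {G : SimpleGraph V} {a b : ℕ} (ha : 0 < a) (hG : Expands G a b) :
    indepRatio G ≤ (a : ℝ) / (a + b) := by
  classical
  obtain ⟨A, hA, hcard⟩ := G.exists_isNIndepSet_indepNum
  have h1 := hG A hA
  have h2 : A.card + (nbr G A).card ≤ Fintype.card V := by
    rw [← card_union_of_disjoint (disjoint_nbr hA)]
    exact card_le_univ _
  rw [indepRatio, ← hcard]
  rcases Nat.eq_zero_or_pos (Fintype.card V) with h0 | h0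
  · rw [h0]; simp; positivity
  · have h0' : (0 : ℝ) < Fintype.card V := by exact_mod_cast h0
    have ha' : (0 : ℝ) < a + b := by positivity
    rw [div_le_div_iff₀ h0' ha']
    have h3 : A.card * (a + b) ≤ a * Fintype.card V := by nlinarith
    exact_mod_cast h3

theorem indepRatio_le_one (G : SimpleGraph V) : indepRatio G ≤ 1 := by
  obtain ⟨A, hA, hcard⟩ := G.exists_isNIndepSet_indepNum
  rw [indepRatio, ← hcard]
  exact div_le_one_of_le₀ (by exact_mod_cast card_le_univ A) (by positivity)

/-- Take A times the whole power, together with R × F, where R is the complement of A ∪ N(A) and F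
is a maximum independent set of the power. No edge of G joins A to R, and within R × F the
independence of F suffices. -/
theorem indepNum_tensorPower_ge {G : SimpleGraph V} {A : Finset V}
    (hA : G.IsIndepSet (A : Set V)) (k : ℕ) :
    A.card * Fintype.card V ^ (k + 1) + (Fintype.card V - (A.card + (nbr G A).card)) *
      (tensorPower G (k + 1)).indepNum ≤ (tensorPower G (k + 2)).indepNum := by
  classical
  obtain ⟨F, hF, hcard⟩ := (tensorPower G (k + 1)).exists_isNIndepSet_indepNum
  set R := (A ∪ nbr G A)ᶜ with hR
  have hRc : R.card = Fintype.card V - (A.card + (nbr G A).card) := by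
    rw [hR, card_compl, card_union_of_disjoint (disjoint_nbr hA)]
  set e := Fin.consEquiv (n := k + 1) (fun _ => V)
  have hd : Disjoint (A ×ˢ (univ : Finset (Fin (k + 1) → V))) (R ×ˢ F) := by
    rw [Finset.disjoint_left]
    rintro ⟨x, y⟩ h1 h2
    simp only [mem_product] at h1 h2
    simp [hR, h1.1] at h2
  have hc : ((A ×ˢ univ ∪ R ×ˢ F).map e.toEmbedding).card = A.card * Fintype.card V ^ (k + 1) +
      (Fintype.card V - (A.card + (nbr G A).card)) * (tensorPower G (k + 1)).indepNum := by
    rw [card_map, card_union_of_disjoint hd, card_product, card_product, hRc, hcard, card_univ]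
    simp
  rw [← hc]
  refine SimpleGraph.IsIndepSet.card_le_indepNum ?_
  rw [isIndepSet_iff] at hA hF ⊢
  simp only [mem_map, forall_exists_index, and_imp, forall_apply_eq_imp_iff₂]
  intro x hx y hy hxy
  have hxy' := (tensorPower_cons_adj G k x y).1 hxy
  simp only [mem_union, mem_product, mem_univ, and_true] at hx hy
  rcases hx with hx | hx <;> rcases hy with hy | hy
  · exact hA _ hx _ hy hxy'.1
  · have := mem_compl.1 hy.1
    exact this (mem_union_right _ (mem_nbr.2 ⟨_, hx, hxy'.1⟩))
  · have := mem_compl.1 hx.1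
    exact this (mem_union_right _ (mem_nbr.2 ⟨_, hy, hxy'.1.symm⟩))
  · exact hF _ hx.2 _ hy.2 hxy'.2

open Filter Topology

/-- The gap between θ = a/(a+b) and the ratio is nonnegative by expansion of the powers, and shrinks
at least by the factor ρ = 1 - (a+b)/n < 1 from one power to the next. -/
theorem hasTensorCapacity_of_expands {G : SimpleGraph V} {A : Finset V}
    (hA : G.IsIndepSet (A : Set V)) (h0 : 0 < A.card) (hle : A.card ≤ (nbr G A).card)
    (hG : Expands G A.card (nbr G A).card) :
    HasTensorCapacity G ((A.card : ℝ) / (A.card + (nbr G A).card)) := by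
  classical
  set a := A.card with ha
  set b := (nbr G A).card with hb
  set n := Fintype.card V with hn
  have hab : a + b ≤ n := by
    rw [ha, hb, ← card_union_of_disjoint (disjoint_nbr hA)]
    exact card_le_univ _
  have h0' : (0 : ℝ) < a := by exact_mod_cast h0
  have hn0 : (0 : ℝ) < n := by
    have : 0 < n := by omega
    exact_mod_cast this
  have hab' : (a : ℝ) + b ≤ n := by exact_mod_cast hab
  set θ : ℝ := (a : ℝ) / (a + b) with hθ
  set ρ : ℝ := 1 - (a + b) / n with hρ
  have hρ0 : 0 ≤ ρ := by rw [hρ, sub_nonneg]; exact div_le_one_of_le₀ hab' hn0.le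
  have hρ1 : ρ < 1 := by
    have : 0 < ((a : ℝ) + b) / n := by positivity
    linarith
  have hup : ∀ k, indepRatio (tensorPower G (k + 1)) ≤ θ := fun k =>
    (hG.tensorPower hle k).indepRatio_le h0
  have hstep : ∀ k, θ - indepRatio (tensorPower G (k + 2)) ≤
      ρ * (θ - indepRatio (tensorPower G (k + 1))) := by
    intro k
    have h1 := indepNum_tensorPower_ge hA k
    have h2 : (a : ℝ) * n ^ (k + 1) + (n - (a + b)) * (tensorPower G (k + 1)).indepNum ≤
        (tensorPower G (k + 2)).indepNum := by
      have : ((n - (a + b) : ℕ) : ℝ) = n - (a + b) := by push_cast [Nat.cast_sub hab]; ring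
      rw [← this]
      exact_mod_cast h1
    have h3 : (a : ℝ) / n + ρ * indepRatio (tensorPower G (k + 1)) ≤
        indepRatio (tensorPower G (k + 2)) := by
      simp only [indepRatio, Fintype.card_pi_const, Nat.cast_pow]
      rw [← hn, le_div_iff₀ (by positivity)]
      refine le_trans (le_of_eq ?_) h2
      rw [hρ]
      field_simp
      ring
    have h4 : θ - ρ * θ = a / n := by
      rw [hθ, hρ]
      field_simp
      ring
    linarith
  have hbound : ∀ k, θ - indepRatio (tensorPower G (k + 1)) ≤
      ρ ^ k * (θ - indepRatio (tensorPower G 1)) := by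
    intro k
    induction k with
    | zero => simp
    | succ k ih =>
      refine (hstep k).trans ?_
      rw [pow_succ', mul_assoc]
      exact mul_le_mul_of_nonneg_left ih hρ0
  have hlim : Tendsto (fun k : ℕ => ρ ^ k * (θ - indepRatio (tensorPower G 1))) atTop (𝓝 0) := by
    simpa using (tendsto_pow_atTop_nhds_zero_of_lt_one hρ0 hρ1).mul_const
      (θ - indepRatio (tensorPower G 1))
  have h5 := squeeze_zero (fun k => sub_nonneg.2 (hup k)) hbound hlim
  rw [HasTensorCapacity, ← tendsto_add_atTop_iff_nat 1]
  simpa using h5.const_sub θ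

/-- Let M be the tuples with more coordinates in A than in N(A). In adjacent tuples each
A-coordinate of one faces an N(A)-coordinate of the other, so both cannot lie in M. For the
complement, weight a coordinate by z > 1 on N(A), by 1/z on A and by 1 elsewhere. Tuples outside M
have weight at least 1, and the total weight is (∑ w)^k, where ∑ w < n for z close enough to 1. -/
theorem hasTensorCapacity_one {G : SimpleGraph V} {A : Finset V}
    (hA : G.IsIndepSet (A : Set V)) (hlt : (nbr G A).card < A.card) : HasTensorCapacity G 1 := by
  classical
  set a := A.card with ha
  set b := (nbr G A).card with hb
  set n := Fintype.card V with hn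
  have han : a ≤ n := card_le_univ _
  have hn0 : (0 : ℝ) < n := by
    have : 0 < n := by omega
    exact_mod_cast this
  have hba : (b : ℝ) + 1 ≤ a := by exact_mod_cast hlt
  have hb0 : (0 : ℝ) ≤ b := by positivity
  obtain ⟨z, hz1, hz⟩ : ∃ z : ℝ, 1 < z ∧ b * z < a := by
    -- The summand 1/2 keeps z above 1, as a ≥ b + 1, makes bz < a strict, and avoids a zero
    -- denominator when b = 0.
    refine ⟨a / (b + 1 / 2), ?_, ?_⟩
    · rw [lt_div_iff₀ (by positivity)]; linarith
    · rw [← mul_div_assoc, div_lt_iff₀ (by positivity)]; nlinarith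
  have hz0 : 0 < z := by linarith
  set w : V → ℝ := fun v => z ^ (if v ∈ nbr G A then 1 else 0) * z⁻¹ ^ (if v ∈ A then 1 else 0)
    with hw
  have hw0 : ∀ v, 0 < w v := fun v => by positivity
  have hwv : ∀ v, w v = 1 + (if v ∈ A then z⁻¹ - 1 else 0) +
      (if v ∈ nbr G A then z - 1 else 0) := by
    intro v
    have hd : v ∈ A → v ∉ nbr G A := fun h => Finset.disjoint_left.1 (disjoint_nbr hA) h
    by_cases h1 : v ∈ A
    · simp [hw, h1, hd h1]
    · by_cases h2 : v ∈ nbr G A <;> simp [hw, h1, h2]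
  have hsum : ∑ v, w v < n := by
    simp_rw [hwv, sum_add_distrib]
    simp only [sum_ite_mem, univ_inter, sum_const, card_univ, nsmul_eq_mul, mul_one]
    rw [← ha, ← hb, ← hn]
    have h1 : (b : ℝ) * (z - 1) < a * (1 - z⁻¹) := by
      have h2 : (a : ℝ) * (1 - z⁻¹) = a / z * (z - 1) := by field_simp
      rw [h2]
      exact mul_lt_mul_of_pos_right ((lt_div_iff₀ hz0).2 hz) (by linarith)
    linarith
  have hlow : ∀ k, 1 - ((∑ v, w v) / n) ^ k ≤ indepRatio (tensorPower G k) := by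
    intro k
    set M : Finset (Fin k → V) := univ.filter fun x =>
      (univ.filter fun i => x i ∈ nbr G A).card < (univ.filter fun i => x i ∈ A).card with hM
    have hMi : (tensorPower G k).IsIndepSet (M : Set (Fin k → V)) := by
      rw [isIndepSet_iff]
      intro x hx y hy hxy
      simp only [hM, mem_filter, mem_univ, true_and] at hx hy
      have h1 : (univ.filter fun i => x i ∈ A).card ≤ (univ.filter fun i => y i ∈ nbr G A).card :=
        card_le_card fun i hi => mem_filter.2 ⟨mem_univ _, mem_nbr.2
          ⟨_, (mem_filter.1 hi).2, hxy.2 i⟩⟩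
      have h2 : (univ.filter fun i => y i ∈ A).card ≤ (univ.filter fun i => x i ∈ nbr G A).card :=
        card_le_card fun i hi => mem_filter.2 ⟨mem_univ _, mem_nbr.2
          ⟨_, (mem_filter.1 hi).2, (hxy.2 i).symm⟩⟩
      omega
    have h1 : (Mᶜ.card : ℝ) ≤ (∑ v, w v) ^ k := by
      have h2 : (∑ v, w v) ^ k = ∑ x : Fin k → V, ∏ i, w (x i) := by
        have h := Finset.prod_univ_sum (fun _ : Fin k => (univ : Finset V)) (fun _ v => w v)
        simpa using h
      rw [h2, card_eq_sum_ones, Nat.cast_sum]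
      refine (sum_le_sum fun x hx => ?_).trans
        (sum_le_sum_of_subset_of_nonneg (subset_univ Mᶜ) fun x _ _ =>
          prod_nonneg fun i _ => (hw0 _).le)
      simp only [hM, mem_compl, mem_filter, mem_univ, true_and, not_lt] at hx
      simp only [hw]
      rw [prod_mul_distrib, prod_pow_eq_pow_sum, prod_pow_eq_pow_sum, ← card_filter,
        ← card_filter, inv_pow, ← div_eq_mul_inv, Nat.cast_one, one_le_div (by positivity)]
      exact pow_le_pow_right₀ hz1.le hx
    have h3 : (M.card : ℝ) ≤ (tensorPower G k).indepNum := by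
      exact_mod_cast SimpleGraph.IsIndepSet.card_le_indepNum hMi
    have h4 : (M.card : ℝ) + Mᶜ.card = n ^ k := by
      have := card_add_card_compl M
      rw [Fintype.card_pi_const] at this
      exact_mod_cast this
    simp only [indepRatio, Fintype.card_pi_const, Nat.cast_pow]
    rw [← hn, le_div_iff₀ (by positivity), sub_mul, div_pow, div_mul_cancel₀ _ (by positivity)]
    linarith
  have hlim : Tendsto (fun k : ℕ => 1 - ((∑ v, w v) / n) ^ k) atTop (𝓝 1) := by
    have h := tendsto_pow_atTop_nhds_zero_of_lt_one
      (div_nonneg (sum_nonneg fun v _ => (hw0 v).le) hn0.le) ((div_lt_one hn0).2 hsum)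
    simpa using h.const_sub 1
  exact tendsto_of_tendsto_of_tendsto_of_le_of_le hlim tendsto_const_nhds hlow
    fun k => indepRatio_le_one _

end Capacity

/-! ### Greedy loads instead of optimal assignments -/

section Load

open Finset

variable {V : Type*} [Fintype V] [DecidableEq V]

/-- A fractional form of Hall's theorem: a set `I` with `q |A| ≤ p |N(A)|` for all `A ⊆ I` admits an
assignment of `q` units of each of its elements to neighbours that get at most `p` units each. -/
theorem exists_assignment (G : SimpleGraph V) (I : Finset V) (p q : ℕ)
    (h : ∀ A ⊆ I, q * A.card ≤ p * (nbr G A).card) :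
    ∃ x : V → V → ℕ, (∀ u ∈ I, ∑ r, x u r = q) ∧ (∀ u r, x u r ≠ 0 → G.Adj u r) ∧
      ∀ r, ∑ u ∈ I, x u r ≤ p := by
  -- Hall's theorem is applied to q copies of each element of I and p copies of each vertex.
  let t : {u // u ∈ I} × Fin q → Finset (V × Fin p) := fun z => nbr G {z.1.1} ×ˢ univ
  obtain ⟨f, hf, hft⟩ := (Finset.all_card_le_biUnion_card_iff_exists_injective t).1 (by
    intro s
    set A := s.image fun z => z.1.1 with hA
    have hAI : A ⊆ I := by
      intro u hu
      obtain ⟨z, -, rfl⟩ := mem_image.1 hu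
      exact z.1.2
    have h1 : s.card ≤ (A ×ˢ (univ : Finset (Fin q))).card := by
      refine card_le_card_of_injOn (fun z => (z.1.1, z.2)) (fun z hz => ?_) ?_
      · simp only [coe_product, coe_univ, Set.mem_prod, Set.mem_univ, and_true, mem_coe]
        exact mem_image_of_mem _ hz
      · rintro ⟨⟨u, hu⟩, i⟩ - ⟨⟨v, hv⟩, j⟩ - hz
        simpa using hz
    have h2 : (nbr G A ×ˢ (univ : Finset (Fin p))).card ≤ (s.biUnion t).card := by
      refine card_le_card ?_
      rintro ⟨r, j⟩ hr
      simp only [mem_product, mem_univ, and_true] at hr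
      obtain ⟨u, hu, hur⟩ := mem_nbr.1 hr
      obtain ⟨z, hz, rfl⟩ := mem_image.1 hu
      refine mem_biUnion.2 ⟨z, hz, ?_⟩
      simp only [t, mem_product, mem_univ, and_true]
      exact mem_nbr.2 ⟨_, mem_singleton_self _, hur⟩
    have h3 := h A hAI
    rw [card_product, card_univ, Fintype.card_fin] at h1 h2
    nlinarith)
  refine ⟨fun u r => (univ.filter fun z => z.1.1 = u ∧ (f z).1 = r).card, ?_, ?_, ?_⟩
  · intro u hu
    have h1 := card_eq_sum_card_fiberwise
      (s := univ.filter fun z : {u // u ∈ I} × Fin q => z.1.1 = u) (t := (univ : Finset V))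
      (f := fun z => (f z).1) (fun _ _ => mem_univ _)
    simp_rw [filter_filter] at h1
    rw [← h1]
    have h2 : (univ.filter fun z : {u // u ∈ I} × Fin q => z.1.1 = u) =
        (univ : Finset (Fin q)).map ⟨fun i => (⟨u, hu⟩, i), fun i j hij => by simpa using hij⟩ := by
      ext ⟨⟨v, hv⟩, i⟩
      simp only [mem_filter, mem_univ, true_and, mem_map]
      constructor
      · rintro rfl
        exact ⟨i, rfl⟩
      · rintro ⟨j, hj⟩
        exact (congrArg (fun z => z.1.1) hj).symm
    rw [h2, card_map, card_univ, Fintype.card_fin]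
  · intro u r hur
    obtain ⟨z, hz⟩ := card_pos.1 (Nat.pos_of_ne_zero hur)
    simp only [mem_filter, mem_univ, true_and] at hz
    have h1 := hft z
    simp only [t, mem_product, mem_univ, and_true] at h1
    obtain ⟨a, ha, har⟩ := mem_nbr.1 h1
    rw [mem_singleton] at ha
    rw [← hz.1, ← hz.2, ← ha]
    exact har
  · intro r
    have h1 := card_eq_sum_card_fiberwise
      (s := univ.filter fun z : {u // u ∈ I} × Fin q => (f z).1 = r) (t := I)
      (f := fun z => z.1.1) (fun z _ => z.1.2)
    simp_rw [filter_filter] at h1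
    have h2 : ∑ u ∈ I, (univ.filter fun z => z.1.1 = u ∧ (f z).1 = r).card =
        (univ.filter fun z => (f z).1 = r).card := by
      rw [h1]
      exact sum_congr rfl fun u _ => by simp_rw [and_comm]
    rw [h2]
    refine (card_le_card_of_injOn (t := (univ : Finset (Fin p))) (fun z => (f z).2)
      (fun _ _ => mem_univ _) ?_).trans_eq (by simp)
    intro z hz z' hz' hzz
    simp only [coe_filter, mem_univ, true_and, Set.mem_ofPred_eq] at hz hz'
    exact hf (Prod.ext (hz.trans hz'.symm) hzz)

/-- Every element of `I` adds one to the load of one of its neighbours, whose load is minimal up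
to the number of vertices. -/
def IsRound (G : SimpleGraph V) (I : Finset V) (L L' : V → ℕ) : Prop :=
  ∃ c : V → V, (∀ u ∈ I, G.Adj u (c u) ∧ ∀ r, G.Adj u r → L (c u) ≤ L r + Fintype.card V) ∧
    ∀ r, L' r = L r + (I.filter fun u => c u = r).card

/-- The properties of the loads after `t` rounds: a lower bound for the loads of neighbourhoods,
and a bound for the excess over the loads of any fractional assignment. -/
def IsLoad (G : SimpleGraph V) (I : Finset V) (t : ℕ) (L : V → ℕ) : Prop :=
  (∀ A ⊆ I, t * A.card ≤ ∑ r ∈ nbr G A, L r) ∧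
  ∀ (p q : ℕ) (x : V → V → ℕ), p ≤ Fintype.card V → q ≤ Fintype.card V →
    (∀ u ∈ I, ∑ r, x u r = q) → (∀ u r, x u r ≠ 0 → G.Adj u r) → (∀ r, ∑ u ∈ I, x u r ≤ p) →
    ∑ r, (max 0 ((q : ℤ) * L r - t * p)) ^ 2 ≤
      t * ((Fintype.card V : ℤ) ^ 5 + 2 * (Fintype.card V : ℤ) ^ 4)


theorem isLoad_zero {V : Type*} [Fintype V] (G : SimpleGraph V) (I : Finset V) : IsLoad G I 0 fun _ => 0 :=
  ⟨fun A _ => by simp, fun p q x _ _ _ _ _ => by simp⟩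

/-- Let D r be the positive part of q L r - t p, and s r the units that r receives in the round.
Then D r grows by at most q s r - p, whose square is at most n^4, in total n^5. For the mixed term,
x spreads the q units of u over neighbours r, and D at the chosen vertex exceeds D r by at most qn.
This gives q ∑ s D ≤ p ∑ D + n^4, and the doubled error is the summand 2n^4. -/
theorem IsLoad.succ {G : SimpleGraph V} {I : Finset V} {t : ℕ} {L L' : V → ℕ}
    (h : IsLoad G I t L) (hr : IsRound G I L L') : IsLoad G I (t + 1) L' := by
  obtain ⟨c, hc, hL⟩ := hr
  set n := Fintype.card V with hn
  set s : V → ℕ := fun r => (I.filter fun u => c u = r).card with hs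
  have hIn : I.card ≤ n := card_le_univ _
  have hsn : ∀ r, s r ≤ n := fun r => card_le_univ _
  refine ⟨fun A hA => ?_, fun p q x hp hq hx1 hx2 hx3 => ?_⟩
  · have h1 := h.1 A hA
    have h2 : A.card ≤ ∑ r ∈ nbr G A, s r := by
      rw [card_eq_sum_card_fiberwise (f := c) (t := nbr G A)
        (fun u hu => mem_nbr.2 ⟨u, hu, (hc u (hA hu)).1⟩)]
      exact sum_le_sum fun r _ => card_le_card (filter_subset_filter _ hA)
    simp_rw [hL, sum_add_distrib]
    rw [add_mul, one_mul]
    exact add_le_add h1 h2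
  · set D : V → ℤ := fun r => max 0 ((q : ℤ) * L r - t * p) with hD
    have hD0 : ∀ r, 0 ≤ D r := fun r => le_max_left _ _
    have h1 : ∑ r, D r ^ 2 ≤ t * ((n : ℤ) ^ 5 + 2 * (n : ℤ) ^ 4) := h.2 p q x hp hq hx1 hx2 hx3
    have h2 : ∀ r, (max 0 ((q : ℤ) * L' r - (t + 1 : ℕ) * p)) ^ 2 ≤
        D r ^ 2 + 2 * (q * (s r * D r) - p * D r) + (n : ℤ) ^ 4 := by
      intro r
      have h3 : (max 0 ((q : ℤ) * L' r - (t + 1 : ℕ) * p)) ^ 2 ≤ (D r + (q * s r - p)) ^ 2 := by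
        rw [hL]
        push_cast
        rcases le_total ((q : ℤ) * (L r + s r) - (t + 1) * p) 0 with h4 | h4
        · rw [max_eq_left h4]; positivity
        · rw [max_eq_right h4]
          refine pow_le_pow_left₀ h4 ?_ 2
          have : (q : ℤ) * L r - t * p ≤ D r := le_max_right _ _
          linarith
      have h4 : ((q : ℤ) * s r - p) ^ 2 ≤ ((n : ℤ) ^ 2) ^ 2 := by
        have h5 : q * s r ≤ n * n := Nat.mul_le_mul hq (hsn r)
        have h6 : p ≤ n * n := hp.trans (Nat.le_mul_self n)
        zify at h5 h6
        refine sq_le_sq.2 ?_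
        rw [abs_of_nonneg (by positivity : (0 : ℤ) ≤ (n : ℤ) ^ 2), abs_le]
        constructor
        · have : 0 ≤ (q : ℤ) * s r := by positivity
          nlinarith
        · have : 0 ≤ (p : ℤ) := by positivity
          nlinarith
      nlinarith
    have h3 : (q : ℤ) * ∑ r, s r * D r ≤ p * ∑ r, D r + (n : ℤ) ^ 4 := by
      have h4 : ∑ r, (s r : ℤ) * D r = ∑ u ∈ I, D (c u) := by
        rw [← sum_fiberwise' I c D]
        simp [hs]
      have h5 : ∀ u ∈ I, (q : ℤ) * D (c u) ≤ ∑ r, (x u r : ℤ) * D r + (n : ℤ) ^ 3 := by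
        intro u hu
        have h6 : ∀ r, (x u r : ℤ) * D (c u) ≤ x u r * D r + x u r * (q * n) := by
          intro r
          rcases Nat.eq_zero_or_pos (x u r) with h0 | h0
          · simp [h0]
          · rw [← mul_add]
            refine mul_le_mul_of_nonneg_left ?_ (by positivity)
            have h7 := (hc u hu).2 r (hx2 u r h0.ne')
            zify at h7
            have h8 : (q : ℤ) * L (c u) ≤ q * L r + q * n := by
              rw [← mul_add]; exact mul_le_mul_of_nonneg_left h7 (by positivity)
            have h9 : (q : ℤ) * L r - t * p ≤ D r := le_max_right _ _
            have h10 : (0 : ℤ) ≤ q * n := by positivity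
            exact max_le (by linarith [hD0 r]) (by linarith)
        have h7 := sum_le_sum fun r (_ : r ∈ univ) => h6 r
        rw [← sum_mul, sum_add_distrib, ← sum_mul, ← Nat.cast_sum, hx1 u hu] at h7
        have h8 : q * (q * n) ≤ n * (n * n) := Nat.mul_le_mul hq (Nat.mul_le_mul_right n hq)
        zify at h8
        linarith
      rw [h4, mul_sum]
      refine (sum_le_sum h5).trans ?_
      rw [sum_add_distrib, sum_comm, mul_sum]
      refine add_le_add (sum_le_sum fun r _ => ?_) ?_
      · rw [← sum_mul]
        refine mul_le_mul_of_nonneg_right ?_ (hD0 r)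
        exact_mod_cast hx3 r
      · rw [sum_const, nsmul_eq_mul]
        have h6 : (I.card : ℤ) ≤ n := by exact_mod_cast hIn
        have h7 : (0 : ℤ) ≤ (n : ℤ) ^ 3 := by positivity
        nlinarith
    refine (sum_le_sum fun r _ => h2 r).trans ?_
    rw [sum_add_distrib, sum_add_distrib, ← mul_sum, sum_sub_distrib, ← mul_sum, ← mul_sum,
      sum_const, card_univ, nsmul_eq_mul, ← hn]
    push_cast
    nlinarith

/-- After sufficiently many rounds a fraction that exceeds the maximum of `|A| / |N(A)|` over the
subsets `A` of `I` exceeds all relative loads. -/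
theorem IsLoad.lt {G : SimpleGraph V} {I : Finset V} {L : V → ℕ} (hn : 2 ≤ Fintype.card V)
    (h : IsLoad G I (Fintype.card V ^ 9) L) {p q p' q' : ℕ} (hp : p ≤ Fintype.card V)
    (hq : q ≤ Fintype.card V) (hq' : q' ≤ Fintype.card V)
    (hI : ∀ A ⊆ I, q * A.card ≤ p * (nbr G A).card) (hlt : p * q' < p' * q) (r : V) :
    L r * q' < p' * Fintype.card V ^ 9 := by
  by_contra! hle
  obtain ⟨x, hx1, hx2, hx3⟩ := exists_assignment G I p q hI
  have h1 := h.2 p q x hp hq hx1 hx2 hx3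
  have h2 := (single_le_sum (fun r _ => by positivity) (mem_univ r)).trans h1
  generalize Fintype.card V = n at *
  set D : ℤ := max 0 ((q : ℤ) * L r - (n ^ 9 : ℕ) * p) with hD
  -- The integers p q' < p' q differ by at least 1, so a load of at least p'/q' per round forces an
  -- excess linear in the number of rounds.
  have h3 : (n : ℤ) ^ 9 ≤ q' * D := by
    have h4 : (q : ℤ) * L r - (n ^ 9 : ℕ) * p ≤ D := le_max_right _ _
    have h5 := mul_le_mul_of_nonneg_left h4 (by positivity : (0 : ℤ) ≤ q')
    have h6 := Nat.mul_le_mul_left q hle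
    have h7 := Nat.mul_le_mul_right (n ^ 9) (Nat.succ_le_of_lt hlt)
    zify at h6 h7
    push_cast at h5
    nlinarith
  have hD0 : 0 ≤ D := le_max_left _ _
  have h4 : (n : ℤ) ^ 9 ≤ n * D :=
    h3.trans (mul_le_mul_of_nonneg_right (by exact_mod_cast hq') hD0)
  have hn' : (2 : ℤ) ≤ n := by exact_mod_cast hn
  have hn0 : (0 : ℤ) < n := by linarith
  have h5 : (n : ℤ) ^ 8 ≤ D := by
    have : (n : ℤ) * n ^ 8 ≤ n * D := by rw [← pow_succ']; exact h4
    exact le_of_mul_le_mul_left this hn0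
  have h6 : ((n : ℤ) ^ 8) ^ 2 ≤ D ^ 2 := pow_le_pow_left₀ (by positivity) h5 2
  push_cast at h2
  -- The linear excess gives D² ≥ n^16, the potential bound D² ≤ n^13 (n + 2). This is contradictory
  -- for n ≥ 2, because n³ > n + 2. With n^8 rounds the same estimate would give no contradiction at
  -- n = 2.
  have h7 : (n : ℤ) ^ 13 * n ^ 3 ≤ n ^ 13 * (n + 2) * 1 := by nlinarith
  have h8 : (n : ℤ) ^ 3 ≤ n + 2 := by
    rw [mul_one] at h7
    exact le_of_mul_le_mul_left h7 (by positivity)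
  nlinarith [pow_pos hn0 2]

end Load

namespace RAM

open Finset

namespace FProg

theorem den_ite_pos {e : Expr} {P Q : FProg} {m : Mem} (h : e.eval m ≠ 0) :
    (ite e P Q).den m = P.den m := if_pos h

theorem den_ite_neg {e : Expr} {P Q : FProg} {m : Mem} (h : e.eval m = 0) :
    (ite e P Q).den m = Q.den m := if_neg (not_not.2 h)

/-! ### Loops that fill an array, count, and minimize -/

/-- Every index `c` with `off ≤ c < off + n` of array `k` gets the value `E (c - off)`. -/
theorem den_fill {i k : ℕ} (hik : i ≠ k) {a e : Expr} {m : Mem} {off : ℕ} {E : ℕ → ℕ}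
    (ha : ∀ m' : Mem, (∀ k', k' ≠ k → k' ≠ i → m' k' = m k') → a.eval m' = off + m' i 0)
    (he : ∀ m' : Mem, (∀ k', k' ≠ k → k' ≠ i → m' k' = m k') → e.eval m' = E (m' i 0)) (c : ℕ) :
    (loop i (set k a e)).den m k c =
      if off ≤ c ∧ c < off + m 0 0 then E (c - off) else m k c := by
  refine den_loop (i := i) (P := set k a e) (m := m) (fun j m' => ∀ c, m' k c =
    if off ≤ c ∧ c < off + j then E (c - off) else m k c) ?_ ?_ c
  · intro c
    rw [write_of_ne hik.symm, if_neg (by omega)]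
  · intro j hj m' hm' hij hI c
    have hag : ∀ k', k' ≠ k → k' ≠ i → m' k' = m k' := fun k' h1 h2 => hm' k' (by simp [mods, h1, h2])
    rw [write_of_ne hik.symm, den, ha m' hag, he m' hag, hij]
    simp only [write, true_and]
    rw [hI c]
    split_ifs <;> first | omega | rfl | skip
    rename_i h1 _
    rw [h1, Nat.add_sub_cancel_left]

/-- Cell `a` of array `k` becomes the number of values of the counter `w` that satisfy `cond`. -/
def count (w k : ℕ) (a cond : Expr) : FProg :=
  .seq (.set k a (.const 0)) (.loop w (.ite cond (.set k a (.add (.get k a) (.const 1))) .skip))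

/-- The expressions are evaluated in every memory that agrees with m off the arrays written by the
loop. Thus they mean the same in each pass and may depend on the counter alone. -/
theorem den_count {w k : ℕ} (hwk : w ≠ k) {a cond : Expr} {m : Mem} {A : ℕ} {F : ℕ → ℕ}
    (hk : k ≠ 0)
    (ha : ∀ m' : Mem, (∀ k', k' ≠ k → k' ≠ w → m' k' = m k') → a.eval m' = A)
    (hc : ∀ m' : Mem, (∀ k', k' ≠ k → k' ≠ w → m' k' = m k') → cond.eval m' = F (m' w 0)) (c : ℕ) :
    (count w k a cond).den m k c =
      if c = A then ((range (m 0 0)).filter fun x => F x ≠ 0).card else m k c := by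
  rw [count, den, den, ha m fun _ _ _ => rfl]
  have h0 : write m k A (Expr.eval m (.const 0)) 0 0 = m 0 0 := by rw [write_of_ne hk.symm]
  rw [← h0]
  refine den_loop (i := w) (P := .ite cond (.set k a (.add (.get k a) (.const 1))) .skip)
    (m := write m k A (Expr.eval m (.const 0))) (fun j m' => ∀ c, m' k c =
    if c = A then ((range j).filter fun x => F x ≠ 0).card else m k c) ?_ ?_ c
  · intro c
    rw [write_of_ne hwk.symm]
    simp [write, Expr.eval]
  · intro j hj m' hm' hij hI c
    have hag : ∀ k', k' ≠ k → k' ≠ w → m' k' = m k' := fun k' h1 h2 => by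
      rw [hm' k' (by simp [mods, h1, h2]), write_of_ne h1]
    rw [write_of_ne hwk.symm, den, hc m' hag, hij, range_add_one, filter_insert]
    by_cases hF : F j = 0
    · simp [hF, den, hI]
    · simp only [ne_eq, hF, not_false_eq_true, if_true, den]
      rw [card_insert_of_notMem (by simp)]
      simp only [Expr.eval, ha m' hag, write, true_and]
      split_ifs with h1
      · rw [hI, if_pos rfl]
      · rw [hI, if_neg h1]

/-- The entries of array `k` become the numbers of `w` that satisfy `cond`, for every `v`. -/
def countRow (v w k : ℕ) (cond : Expr) : FProg := .loop v (count w k (rd v) cond)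

theorem den_countRow {v w k : ℕ} (hwk : w ≠ k) (hvk : v ≠ k) (hvw : v ≠ w) (hk : k ≠ 0)
    (hv : v ≠ 0) (hw : w ≠ 0) {cond : Expr} {m : Mem} {F : ℕ → ℕ → ℕ}
    (hc : ∀ m' : Mem, (∀ k', k' ≠ k → k' ≠ w → k' ≠ v → m' k' = m k') →
      cond.eval m' = F (m' v 0) (m' w 0)) {x : ℕ} (hx : x < m 0 0) :
    (countRow v w k cond).den m k x = ((range (m 0 0)).filter fun y => F x y ≠ 0).card := by
  refine den_loop (i := v) (P := count w k (rd v) cond) (m := m) (fun j m' => ∀ x < j, m' k x =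
    ((range (m 0 0)).filter fun y => F x y ≠ 0).card) (by simp) ?_ x hx
  intro j hj m' hm' hvj hI x hx
  have hag : ∀ k', k' ≠ k → k' ≠ w → k' ≠ v → m' k' = m k' := fun k' h1 h2 h3 =>
    hm' k' (by simp [mods, count, h1, h2, h3])
  rw [write_of_ne hvk.symm, den_count (A := j) (F := F j) hwk hk]
  · rw [hag 0 hk.symm hw.symm hv.symm]
    split_ifs with h
    · rw [h]
    · exact hI x (by omega)
  · intro m'' h
    simp [Expr.eval, h v hvk hvw, hvj]
  · intro m'' h
    rw [hc m'' fun k' h1 h2 h3 => (h k' h1 h2).trans (hag k' h1 h2 h3), h v hvk hvw, hvj]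

/-- The variable `7` becomes a value of the counter `i` with smallest `key` among those that
satisfy `flag`, or `n` if there are none. -/
def argmin (i : ℕ) (flag key : Expr) : FProg :=
  .seq (.set 7 (.const 0) (rd 0)) (.loop i (.ite
    (.mul flag (.add (.sub (.add (rd 7) (.const 1)) (rd 0)) (.sub (rd 8) key)))
    (.seq (.set 8 (.const 0) key) (.set 7 (.const 0) (rd i))) .skip))

theorem den_argmin {i : ℕ} (h7 : i ≠ 7) (h8 : i ≠ 8) (h0 : i ≠ 0) {flag key : Expr} {m : Mem}
    {F κ : ℕ → ℕ}
    (hf : ∀ m' : Mem, (∀ k', k' ≠ 7 → k' ≠ 8 → k' ≠ i → m' k' = m k') → flag.eval m' = F (m' i 0))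
    (hk : ∀ m' : Mem, (∀ k', k' ≠ 7 → k' ≠ 8 → k' ≠ i → m' k' = m k') → key.eval m' = κ (m' i 0)) :
    ((argmin i flag key).den m 7 0 = m 0 0 ∧ ∀ v < m 0 0, F v = 0) ∨
    ((argmin i flag key).den m 7 0 < m 0 0 ∧ F ((argmin i flag key).den m 7 0) ≠ 0 ∧
      ∀ v < m 0 0, F v ≠ 0 → κ ((argmin i flag key).den m 7 0) ≤ κ v) := by
  -- The invariant must also record that the variable 8 caches the key of the current candidate.
  suffices H : ((argmin i flag key).den m 7 0 = m 0 0 ∧ ∀ v < m 0 0, F v = 0) ∨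
    ((argmin i flag key).den m 7 0 < m 0 0 ∧ F ((argmin i flag key).den m 7 0) ≠ 0 ∧
      (argmin i flag key).den m 8 0 = κ ((argmin i flag key).den m 7 0) ∧
      ∀ v < m 0 0, F v ≠ 0 → κ ((argmin i flag key).den m 7 0) ≤ κ v) by
    rcases H with H | ⟨h1, h2, -, h3⟩
    exacts [Or.inl H, Or.inr ⟨h1, h2, h3⟩]
  rw [argmin, den, den]
  set m₀ := write m 7 (Expr.eval m (.const 0)) (Expr.eval m (rd 0)) with hm₀
  have h00 : m₀ 0 0 = m 0 0 := by rw [hm₀, write_of_ne (by norm_num)]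
  have h := den_loop (i := i) (P := .ite
    (.mul flag (.add (.sub (.add (rd 7) (.const 1)) (rd 0)) (.sub (rd 8) key)))
    (.seq (.set 8 (.const 0) key) (.set 7 (.const 0) (rd i))) .skip) (m := m₀)
    (fun j m' => (m' 7 0 = m 0 0 ∧ ∀ v < j, F v = 0) ∨ (m' 7 0 < m 0 0 ∧ F (m' 7 0) ≠ 0 ∧
      m' 8 0 = κ (m' 7 0) ∧ ∀ v < j, F v ≠ 0 → κ (m' 7 0) ≤ κ v)) ?_ ?_
  · rw [h00] at h
    exact h
  · left
    rw [write_of_ne h7.symm, hm₀]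
    simp [Expr.eval]
  · intro j hj m' hm' hij hI
    have hag : ∀ k', k' ≠ 7 → k' ≠ 8 → k' ≠ i → m' k' = m k' := fun k' h1 h2 h3 => by
      rw [hm' k' (by simp [mods, h1, h2, h3]), hm₀, write_of_ne h1]
    have e0 : m' 0 0 = m 0 0 := by rw [hag 0 (by norm_num) (by norm_num) h0.symm]
    have hev : Expr.eval m'
        (.mul flag (.add (.sub (.add (rd 7) (.const 1)) (rd 0)) (.sub (rd 8) key))) =
        F j * (m' 7 0 + 1 - m 0 0 + (m' 8 0 - κ j)) := by
      simp only [Expr.eval, hf m' hag, hk m' hag, hij, e0]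
    -- The first summand is nonzero exactly when the variable 7 still has its default value n, that
    -- is, when there is no candidate yet. The content of the variable 8 is then irrelevant.
    have hcond : (F j * (m' 7 0 + 1 - m 0 0 + (m' 8 0 - κ j)) ≠ 0) ↔
        F j ≠ 0 ∧ (m 0 0 ≤ m' 7 0 ∨ κ j < m' 8 0) := by
      rw [mul_ne_zero_iff]
      omega
    rw [← hev] at hcond
    rw [h00] at hj
    rw [write_of_ne h7.symm, write_of_ne h8.symm]
    by_cases hup : F j ≠ 0 ∧ (m 0 0 ≤ m' 7 0 ∨ κ j < m' 8 0)
    · rw [den_ite_pos (hcond.2 hup)]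
      have e1 : (FProg.seq (.set 8 (.const 0) key) (.set 7 (.const 0) (rd i))).den m' =
          write (write m' 8 0 (κ j)) 7 0 j := by
        simp [den, Expr.eval, write_of_ne h8, hij, hk m' hag]
      rw [e1, write_same, write_of_ne (by norm_num), write_same]
      refine Or.inr ⟨hj, hup.1, rfl, fun v hv hFv => ?_⟩
      rcases Nat.lt_succ_iff_lt_or_eq.1 hv with h | rfl
      · rcases hI with ⟨h1, h2⟩ | ⟨h1, h2, h3, h4⟩
        · exact absurd (h2 v h) hFv
        · have := h4 v h hFv
          omega
      · exact le_rfl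
    · rw [den_ite_neg (not_ne_iff.1 (hcond.not.2 hup)), den]
      rcases hI with ⟨h1, h2⟩ | ⟨h1, h2, h3, h4⟩
      · refine Or.inl ⟨h1, fun v hv => ?_⟩
        rcases Nat.lt_succ_iff_lt_or_eq.1 hv with h | rfl
        · exact h2 v h
        · by_contra hFv
          exact hup ⟨hFv, Or.inl h1.ge⟩
      · refine Or.inr ⟨h1, h2, h3, fun v hv hFv => ?_⟩
        rcases Nat.lt_succ_iff_lt_or_eq.1 hv with h | rfl
        · exact h4 v h hFv
        · by_contra hlt
          exact hup ⟨hFv, Or.inr (by omega)⟩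

/-- The program `P`, repeated `n ^ d` times; the counters are `30`, …, `30 + d - 1`. -/
def rep (P : FProg) : ℕ → FProg
  | 0 => P
  | d + 1 => .loop (30 + d) (rep P d)

theorem notMem_mods_rep {P : FProg} {k : ℕ} (hk : k ∉ P.mods) (hk' : k < 30) (d : ℕ) :
    k ∉ (P.rep d).mods := by
  induction d with
  | zero => exact hk
  | succ d ih =>
    simp only [rep, mods, List.mem_cons, not_or]
    exact ⟨by omega, ih⟩

/-- `Inv t` has to survive writes to the arrays from 30 on, since the counters of the nested loops
live there. The exponent is a fixed number of loops because the only loop bound available is n. -/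
theorem den_rep {P : FProg} {n : ℕ} (h0 : 0 ∉ P.mods) (Inv : ℕ → Mem → Prop)
    (hP : ∀ t m, m 0 0 = n → Inv t m → Inv (t + 1) (P.den m))
    (hw : ∀ t m k x, 30 ≤ k → Inv t m → Inv t (write m k 0 x)) (d t : ℕ) (m : Mem)
    (hm : m 0 0 = n) (hI : Inv t m) : Inv (t + n ^ d) ((P.rep d).den m) := by
  induction d generalizing t m with
  | zero => exact hP t m hm hI
  | succ d ih =>
    have h := den_loop (i := 30 + d) (P := P.rep d) (m := m) (fun j m' => Inv (t + j * n ^ d) m')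
      ?_ ?_
    · rw [hm] at h
      rw [pow_succ']
      exact h
    · simpa using hw t m _ 0 (Nat.le_add_right _ _) hI
    · intro j hj m' hm' _ hI'
      refine hw _ _ _ _ (Nat.le_add_right _ _) ?_
      rw [add_mul, one_mul, ← add_assoc]
      refine ih _ _ ?_ hI'
      rw [hm' 0, hm]
      exact notMem_mods_rep (d := d + 1) h0 (by norm_num)

end FProg

/-! ### The program -/

/-- The entry of the adjacency matrix in the row and column given by two variables. -/
abbrev adjE (i j : ℕ) : Expr := .get 1 (.add (.mul (rd i) (rd 0)) (rd j))

/-- Equality of two variables. -/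
abbrev eqE (i j : ℕ) : Expr := .sub (.const 1) (.add (.sub (rd i) (rd j)) (.sub (rd j) (rd i)))

/-- `1 - x`. -/
abbrev notE (e : Expr) : Expr := .sub (.const 1) e

open FProg

/-- Takes the last set from the stack in array `3` and writes it to array `4`. -/
def popProg : FProg :=
  .seq (.set 2 (.const 0) (.sub (rd 2) (.const 1)))
    (.loop 20 (.set 4 (rd 20) (.get 3 (.add (.mul (rd 2) (rd 0)) (rd 20)))))

/-- Chooses a vertex of smallest degree in the graph without the closed neighbourhood of the set in
array `4`. -/
def chooseProg : FProg :=
  .seq (countRow 20 21 5 (.mul (.get 4 (rd 21)) (.add (eqE 20 21) (adjE 20 21))))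
    (.seq (countRow 20 21 9 (.mul (notE (.get 5 (rd 21))) (adjE 20 21)))
      (argmin 20 (notE (.get 5 (rd 20))) (.get 9 (rd 20))))

/-- One round of adding loads. -/
def roundProg : FProg :=
  .loop 20 (.ite (.get 4 (rd 20)) (.seq (argmin 21 (adjE 20 21) (.get 6 (rd 21)))
    (.set 6 (rd 7) (.add (.get 6 (rd 7)) (.const 1)))) .skip)

/-- Computes loads for the set in array `4` and updates the maximal load in the variable `11`. -/
def leafProg : FProg :=
  .seq (.loop 20 (.set 6 (rd 20) (.const 0))) (.seq (roundProg.rep 9)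
    (.loop 20 (.ite (.sub (.get 6 (rd 20)) (rd 11)) (.set 11 (.const 0) (.get 6 (rd 20))) .skip)))

/-- Adds the set in array `4` as the last set of the stack, together with the vertex in the
variable `20`. -/
def pushProg : FProg :=
  .seq (.loop 21 (.set 3 (.add (.mul (rd 2) (rd 0)) (rd 21)) (.get 4 (rd 21))))
    (.seq (.set 3 (.add (.mul (rd 2) (rd 0)) (rd 20)) (.const 1))
      (.set 2 (.const 0) (.add (rd 2) (.const 1))))

/-- Pushes the extensions of the set in array `4` by the elements of the closed neighbourhood of
the chosen vertex. -/
def branchProg : FProg :=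
  .loop 20 (.ite (.mul (notE (.get 5 (rd 20))) (.add (eqE 20 7) (adjE 7 20))) pushProg .skip)

/-- Replaces the last set of the stack by extensions, or handles it if there are none. -/
def bodyProg : FProg :=
  .seq popProg (.seq chooseProg (.ite (.sub (rd 0) (rd 7)) branchProg leafProg))

/-- Counts the isolated vertices in the variable `12`, and puts the empty set on the stack if there
are none. -/
def startProg : FProg :=
  .seq (countRow 20 21 9 (adjE 20 21)) (.seq (count 20 12 (.const 0) (notE (.get 9 (rd 20))))
    (.set 2 (.const 0) (notE (rd 12))))

/-- `n ^ d`. -/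
def powE : ℕ → Expr
  | 0 => .const 1
  | d + 1 => .mul (powE d) (rd 0)

/-- Sets the fraction in the variables `13` and `14` to `1 / 1`. -/
def oneProg : FProg :=
  .seq (.set 13 (.const 0) (.const 1)) (.set 14 (.const 0) (.const 1))

/-- Finds the largest fraction that is compatible with the maximal load. -/
def searchProg : FProg :=
  .seq (.set 13 (.const 0) (.const 0)) (.seq (.set 14 (.const 0) (.const 1))
    (.loop 20 (.loop 21 (.ite (.mul
      (.sub (.add (.mul (rd 11) (.sub (rd 21) (rd 20))) (.const 1))
        (.mul (.add (rd 20) (.const 1)) (powE 9)))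
      (.sub (.mul (.add (rd 20) (.const 1)) (rd 14)) (.mul (rd 13) (.add (rd 21) (.const 1)))))
      (.seq (.set 13 (.const 0) (.add (rd 20) (.const 1)))
        (.set 14 (.const 0) (.add (rd 21) (.const 1)))) .skip))))

/-- Computes numerator and denominator from the maximal load. -/
def finalProg : FProg :=
  .seq searchProg (.seq (.ite (.sub (.add (rd 13) (rd 13)) (rd 14)) oneProg .skip)
    (.ite (rd 12) oneProg .skip))

/-- The program that computes the tensor capacity. -/
def capacityProg : Prog :=
  .seq startProg.toProg (.seq (.loop (rd 2) bodyProg.toProg) (.seq finalProg.toProg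
    (.seq (.set 0 (.const 1) (rd 14)) (.set 0 (.const 0) (rd 13)))))

theorem wf_startProg : startProg.wf = true := by decide
theorem wf_bodyProg : bodyProg.wf = true := by decide
theorem wf_finalProg : finalProg.wf = true := by decide

end RAM

/-! ### Correctness of the subprograms -/

open Finset in
/-- The vertices outside the closed neighbourhood of `C`. -/
noncomputable def outside {V : Type*} [Fintype V] (G : SimpleGraph V) (C : Finset V) :
    Finset V := by
  classical exact univ.filter fun v => v ∉ C ∧ ∀ w ∈ C, ¬ G.Adj v w

theorem mem_outside {V : Type*} [Fintype V] {G : SimpleGraph V} {C : Finset V} {v : V} :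
    v ∈ outside G C ↔ v ∉ C ∧ ∀ w ∈ C, ¬ G.Adj v w := by
  simp [outside]

namespace RAM

open Finset FProg

variable {n : ℕ}

/-- The set of vertices with a nonzero entry in the block of an array that starts at `off`. -/
def supp (n : ℕ) (a : ℕ → ℕ) (off : ℕ) : Finset (Fin n) := univ.filter fun v => a (off + v) ≠ 0

theorem mem_supp {a : ℕ → ℕ} {off : ℕ} {v : Fin n} : v ∈ supp n a off ↔ a (off + v) ≠ 0 := by
  simp [supp]

theorem supp_congr {a a' : ℕ → ℕ} {off off' : ℕ} (h : ∀ v < n, a (off + v) = a' (off' + v)) :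
    supp n a off = supp n a' off' := by
  ext v
  rw [mem_supp, mem_supp, h v v.2]

/-- The memory holds the number of vertices and the adjacency matrix of `G`. -/
structure IsInput (G : SimpleGraph (Fin n)) (m : Mem) : Prop where
  card : m 0 0 = n
  adj : ∀ i j : Fin n, m 1 (i * n + j) ≠ 0 ↔ G.Adj i j

theorem IsInput.congr {G : SimpleGraph (Fin n)} {m m' : Mem} (h : IsInput G m)
    (h0 : m' 0 = m 0) (h1 : m' 1 = m 1) : IsInput G m' :=
  ⟨by rw [h0, h.card], fun i j => by rw [h1, h.adj]⟩

theorem card_filter_range (P : ℕ → Prop) [DecidablePred P] :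
    ((range n).filter P).card = (univ.filter fun v : Fin n => P v).card := by
  rw [← card_map Fin.valEmbedding]
  congr 1
  ext x
  simp only [mem_filter, mem_range, mem_map, mem_univ, true_and, Fin.valEmbedding_apply]
  constructor
  · rintro ⟨h1, h2⟩
    exact ⟨⟨x, h1⟩, h2, rfl⟩
  · rintro ⟨v, h1, rfl⟩
    exact ⟨v.2, h1⟩

theorem popProg_spec {m : Mem} (h0 : m 0 0 = n) : popProg.den m 2 0 = m 2 0 - 1 ∧
    supp n (popProg.den m 4) 0 = supp n (m 3) ((m 2 0 - 1) * n) := by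
  have e1 : (FProg.set 2 (.const 0) (.sub (rd 2) (.const 1))).den m = write m 2 0 (m 2 0 - 1) := rfl
  refine ⟨?_, supp_congr fun v hv => ?_⟩
  · rw [popProg, den, e1, den_apply (by decide), write_same]
  · rw [popProg, den, e1, den_fill (off := 0) (E := fun x => m 3 ((m 2 0 - 1) * n + x))]
    · rw [write_of_ne (by norm_num), h0, if_pos (by omega)]
      simp
    · norm_num
    · intro m' _
      simp [Expr.eval]
    · intro m' h
      simp [Expr.eval, h 2, h 3, h 0, write, h0]

/-- Array 5 counts the members of C equal or adjacent to v, so its zeros are the vertices outside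
the closed neighbourhood. Array 9 counts neighbours among these. The value n signals that none is
left, so an independent C is then maximal. -/
theorem chooseProg_spec {G : SimpleGraph (Fin n)} {m : Mem} (h : IsInput G m) {C : Finset (Fin n)}
    (hC : C = supp n (m 4) 0) :
    (∀ v : Fin n, chooseProg.den m 5 v = 0 ↔ v ∈ outside G C) ∧
    ((chooseProg.den m 7 0 = n ∧ outside G C = ∅) ∨ ∃ b : Fin n, chooseProg.den m 7 0 = b ∧
      b ∈ outside G C ∧ ∀ v ∈ outside G C,
        (outside G C ∩ nbr G {b}).card ≤ (outside G C ∩ nbr G {v}).card) := by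
  have h0 := h.card
  rw [chooseProg, den, den]
  set m₁ := (countRow 20 21 5
    (.mul (.get 4 (rd 21)) (.add (eqE 20 21) (adjE 20 21)))).den m with hm₁
  set m₂ := (countRow 20 21 9 (.mul (notE (.get 5 (rd 21))) (adjE 20 21))).den m₁ with hm₂
  have f1 : ∀ k, k ≠ 5 → k ≠ 20 → k ≠ 21 → m₁ k = m k := fun k h1 h2 h3 =>
    den_apply (by simp [mods, count, countRow, h1, h2, h3]) m
  have f2 : ∀ k, k ≠ 9 → k ≠ 20 → k ≠ 21 → m₂ k = m₁ k := fun k h1 h2 h3 =>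
    den_apply (by simp [mods, count, countRow, h1, h2, h3]) m₁
  have hR : ∀ v : Fin n, m₁ 5 v = 0 ↔ v ∈ outside G C := by
    intro v
    rw [hm₁, den_countRow (F := fun x y => m 4 y * (1 - (x - y + (y - x)) + m 1 (x * n + y)))
      (by norm_num) (by norm_num) (by norm_num) (by norm_num) (by norm_num) (by norm_num) ?_
      (by rw [h0]; exact v.2)]
    · rw [card_eq_zero, filter_eq_empty_iff, h0, mem_outside]
      simp only [mem_range, not_not, hC, mem_supp, zero_add]
      constructor
      · refine fun H => ⟨?_, fun w hw hvw => ?_⟩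
        · have := H v.2
          simpa using this
        · have := H w.2
          rw [Nat.mul_eq_zero] at this
          rcases this with h2 | h2
          · exact hw h2
          · exact (h.adj v w).2 hvw (by omega)
      · rintro ⟨h1, h2⟩ y hy
        by_cases hy4 : m 4 y = 0
        · simp [hy4]
        · have h3 := h2 ⟨y, hy⟩ hy4
          rw [← h.adj, not_not] at h3
          have h4 : (v : ℕ) ≠ y := by rintro rfl; exact hy4 h1
          simp only at h3
          rw [h3]
          simp only [add_zero, mul_eq_zero]
          omega
    · intro m' h'
      simp [Expr.eval, h' 4, h' 1, h' 0, h0]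
  have hD : ∀ v : Fin n, m₂ 9 v = (outside G C ∩ nbr G {v}).card := by
    intro v
    have h10 : m₁ 0 0 = n := by rw [f1 0 (by norm_num) (by norm_num) (by norm_num), h0]
    rw [hm₂, den_countRow (F := fun x y => (1 - m₁ 5 y) * m 1 (x * n + y))
      (by norm_num) (by norm_num) (by norm_num) (by norm_num) (by norm_num) (by norm_num) ?_
      (by rw [h10]; exact v.2)]
    · rw [h10, card_filter_range]
      congr 1
      ext w
      simp only [mem_filter, mem_univ, true_and, mem_inter, ← hR, mem_nbr, mem_singleton,
        exists_eq_left, ← h.adj, mul_ne_zero_iff]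
      refine and_congr_left fun _ => ?_
      omega
    · intro m' h'
      simp [Expr.eval, h' 5, h' 1, h' 0, f1 1, f1 0, h0]
  have h20 : m₂ 0 0 = n := by
    rw [f2 0 (by norm_num) (by norm_num) (by norm_num), f1 0 (by norm_num) (by norm_num)
      (by norm_num), h0]
  have hR2 : ∀ v : Fin n, m₂ 5 v = 0 ↔ v ∈ outside G C := by
    intro v
    rw [f2 5 (by norm_num) (by norm_num) (by norm_num), hR]
  have hnot : ∀ v : Fin n, 1 - m₂ 5 v ≠ 0 ↔ v ∈ outside G C := fun v => by
    rw [← hR2]; omega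
  refine ⟨fun v => by rw [den_apply (by decide), hR2], ?_⟩
  have hA := den_argmin (i := 20) (flag := notE (.get 5 (rd 20))) (key := .get 9 (rd 20))
    (m := m₂) (F := fun x => 1 - m₂ 5 x) (κ := fun x => m₂ 9 x) (by norm_num) (by norm_num)
    (by norm_num) (fun m' h' => by simp [Expr.eval, h' 5]) (fun m' h' => by simp [Expr.eval, h' 9])
  rw [h20] at hA
  rcases hA with ⟨h1, h2⟩ | ⟨h1, h2, h3⟩
  · refine Or.inl ⟨h1, ?_⟩
    rw [eq_empty_iff_forall_notMem]
    exact fun v hv => (hnot v).2 hv (h2 v v.2)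
  · refine Or.inr ⟨⟨_, h1⟩, rfl, (hnot ⟨_, h1⟩).1 h2, fun v hv => ?_⟩
    rw [← hD, ← hD]
    exact h3 v v.2 ((hnot v).2 hv)

/-- The elements of C act one after another, each choosing a minimum of the loads at that moment.
Those differ from the loads at the start of the round by at most n, which is the slack in `IsRound`.
Without isolated vertices the search for a neighbour always succeeds. -/
theorem roundProg_spec {G : SimpleGraph (Fin n)} {m : Mem} (h : IsInput G m) {C : Finset (Fin n)}
    (hC : C = supp n (m 4) 0) (hG : ∀ v, ∃ w, G.Adj v w) :
    IsRound G C (fun v => m 6 v) (fun v => roundProg.den m 6 v) := by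
  have h0 := h.card
  have H := den_loop (i := 20) (P := .ite (.get 4 (rd 20)) (.seq (argmin 21 (adjE 20 21)
    (.get 6 (rd 21))) (.set 6 (rd 7) (.add (.get 6 (rd 7)) (.const 1)))) .skip) (m := m)
    (fun j m' => ∃ c : Fin n → Fin n, (∀ u ∈ C, (u : ℕ) < j → G.Adj u (c u) ∧
      ∀ r, G.Adj u r → m 6 (c u) ≤ m 6 r + n) ∧
      ∀ r : Fin n, m' 6 r = m 6 r + (C.filter fun u : Fin n => (u : ℕ) < j ∧ c u = r).card) ?_ ?_
  · obtain ⟨c, h1, h2⟩ := H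
    refine ⟨c, fun u hu => ?_, fun r => ?_⟩
    · rw [Fintype.card_fin]
      exact h1 u hu (by rw [h0]; exact u.2)
    · simp only [roundProg]
      rw [h2, h0]
      simp
  · exact ⟨fun v => v, by simp, fun r => by simp [write]⟩
  · intro j hj m' hm' hmj ⟨c, h1, h2⟩
    have hag : ∀ k, k ≠ 20 → k ≠ 21 → k ≠ 7 → k ≠ 8 → k ≠ 6 → m' k = m k := fun k a1 a2 a3 a4 a5 =>
      hm' k (by simp [mods, argmin, a1, a2, a3, a4, a5])
    have e0 : m' 0 = m 0 := hag 0 (by decide) (by decide) (by decide) (by decide) (by decide)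
    have e1 : m' 1 = m 1 := hag 1 (by decide) (by decide) (by decide) (by decide) (by decide)
    have e4 : m' 4 = m 4 := hag 4 (by decide) (by decide) (by decide) (by decide) (by decide)
    rw [h0] at hj
    have e00 : m' 0 0 = n := by rw [e0, h0]
    have hCj : Expr.eval m' (.get 4 (rd 20)) ≠ 0 ↔ (⟨j, hj⟩ : Fin n) ∈ C := by
      rw [hC, mem_supp]
      simp [Expr.eval, e4, hmj]
    rw [write_of_ne (by norm_num)]
    by_cases hjC : (⟨j, hj⟩ : Fin n) ∈ C
    · rw [den_ite_pos (hCj.2 hjC), den]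
      set m₁ := (argmin 21 (adjE 20 21) (.get 6 (rd 21))).den m' with hm₁
      have e6 : m₁ 6 = m' 6 := den_apply (by decide) _
      have hA := den_argmin (i := 21) (flag := adjE 20 21) (key := .get 6 (rd 21))
        (m := m') (F := fun x => m 1 (j * n + x)) (κ := fun x => m' 6 x) (by norm_num) (by norm_num)
        (by norm_num) (fun m'' h' => by simp [Expr.eval, h' 1, h' 0, h' 20, e1, hmj, e00])
        (fun m'' h' => by simp [Expr.eval, h' 6])
      rw [← hm₁, e00] at hA
      rcases hA with ⟨-, h4⟩ | ⟨h3, h4, h5⟩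
      · obtain ⟨w, hw⟩ := hG ⟨j, hj⟩
        exact absurd (h4 w w.2) ((h.adj _ _).2 hw)
      · set b : Fin n := ⟨_, h3⟩ with hb
        have hb' : m₁ 7 0 = b := rfl
        rw [hb'] at h4 h5
        have hjb : G.Adj ⟨j, hj⟩ b := (h.adj _ _).1 h4
        refine ⟨Function.update c ⟨j, hj⟩ b, fun u hu huj => ?_, fun r => ?_⟩
        · by_cases huj' : u = ⟨j, hj⟩
          · subst huj'
            rw [Function.update_self]
            refine ⟨hjb, fun r hr => ?_⟩
            have h6 := h5 r r.2 ((h.adj _ _).2 hr)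
            have h7 := h2 b
            have h8 := h2 r
            have h9 : (C.filter fun u : Fin n => (u : ℕ) < j ∧ c u = r).card ≤ n :=
              (card_le_univ _).trans_eq (Fintype.card_fin n)
            omega
          · rw [Function.update_of_ne huj']
            refine h1 u hu ?_
            have : (u : ℕ) ≠ j := fun h => huj' (Fin.ext h)
            omega
        · have e2 : (FProg.set 6 (rd 7) (.add (.get 6 (rd 7)) (.const 1))).den m₁ =
              write m₁ 6 b (m' 6 b + 1) := by
            simp [den, Expr.eval, hb', e6]
          have h6 : (C.filter fun u : Fin n => (u : ℕ) < j + 1 ∧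
              Function.update c ⟨j, hj⟩ b u = r) =
              if r = b then insert ⟨j, hj⟩ (C.filter fun u : Fin n => (u : ℕ) < j ∧ c u = r)
              else C.filter fun u : Fin n => (u : ℕ) < j ∧ c u = r := by
            ext u
            by_cases huj' : u = ⟨j, hj⟩
            · subst huj'
              by_cases hrb : r = b
              · simp [hrb, hjC]
              · simp [hrb, Ne.symm hrb]
            · have : (u : ℕ) ≠ j := fun h => huj' (Fin.ext h)
              have h7 : (u : ℕ) < j + 1 ↔ (u : ℕ) < j := by omega
              split_ifs <;> simp only [mem_filter, mem_insert, huj', false_or, h7, ne_eq,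
                not_false_eq_true, Function.update_of_ne]
          rw [e2, h6]
          simp only [write, true_and, e6, Fin.val_inj]
          split_ifs with h7
          · rw [card_insert_of_notMem (by simp), ← h7, h2]
            ring
          · exact h2 r
    · rw [den_ite_neg (not_ne_iff.1 (hCj.not.2 hjC)), den]
      have aux : ∀ u ∈ C, (u : ℕ) < j + 1 → (u : ℕ) < j := by
        intro u hu huj
        rcases Nat.lt_succ_iff_lt_or_eq.1 huj with h3 | h3
        · exact h3
        · exact absurd hu (by rw [show u = ⟨j, hj⟩ from Fin.ext h3]; exact hjC)
      refine ⟨c, fun u hu huj => h1 u hu (aux u hu huj), fun r => ?_⟩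
      rw [h2]
      congr 2
      refine filter_congr fun (u : Fin n) hu => ?_
      exact ⟨fun h3 => ⟨by omega, h3.2⟩, fun h3 => ⟨aux u hu h3.1, h3.2⟩⟩

/-- That a changed maximum is attained by some load matters as much as the bound: it is what later
makes `IsLoad.lt` applicable to the final maximum. -/
theorem leafProg_spec {G : SimpleGraph (Fin n)} {m : Mem} (h : IsInput G m) {C : Finset (Fin n)}
    (hC : C = supp n (m 4) 0) (hG : ∀ v, ∃ w, G.Adj v w) :
    ∃ L : Fin n → ℕ, IsLoad G C (n ^ 9) L ∧ m 11 0 ≤ leafProg.den m 11 0 ∧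
      (∀ v, L v ≤ leafProg.den m 11 0) ∧
      (leafProg.den m 11 0 = m 11 0 ∨ ∃ v, leafProg.den m 11 0 = L v) := by
  rw [leafProg, den, den]
  set m₁ := (FProg.loop 20 (.set 6 (rd 20) (.const 0))).den m with hm₁
  have f1 : ∀ k, k ≠ 6 → k ≠ 20 → m₁ k = m k := fun k h1 h2 =>
    den_apply (by simp [mods, h1, h2]) m
  have h6 : ∀ v : Fin n, m₁ 6 v = 0 := by
    intro v
    rw [hm₁, den_fill (off := 0) (E := fun _ => 0) (by norm_num)]
    · rw [h.card, if_pos (by omega)]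
    · intro m' _
      simp [Expr.eval]
    · intro m' _
      simp [Expr.eval]
  set m₂ := (roundProg.rep 9).den m₁ with hm₂
  have hL := den_rep (P := roundProg) (n := n) (by decide)
    (fun t m' => m' 0 = m 0 ∧ m' 1 = m 1 ∧ m' 4 = m 4 ∧ IsLoad G C t fun v => m' 6 v) ?_ ?_
    9 0 m₁ ?_ ?_
  rotate_left
  · rintro t m' hm' ⟨h1, h2, h3, h4⟩
    refine ⟨by rw [den_apply (by decide), h1], by rw [den_apply (by decide), h2],
      by rw [den_apply (by decide), h3], h4.succ ?_⟩
    exact roundProg_spec (h.congr h1 h2) (by rw [h3, hC]) hG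
  · rintro t m' k x hk ⟨h1, h2, h3, h4⟩
    refine ⟨by rw [write_of_ne (by omega), h1], by rw [write_of_ne (by omega), h2],
      by rw [write_of_ne (by omega), h3], ?_⟩
    rw [write_of_ne (by omega)]
    exact h4
  · rw [f1 0 (by norm_num) (by norm_num), h.card]
  · refine ⟨f1 0 (by norm_num) (by norm_num), f1 1 (by norm_num) (by norm_num),
      f1 4 (by norm_num) (by norm_num), ?_⟩
    simp_rw [h6]
    exact isLoad_zero G C
  rw [zero_add, ← hm₂] at hL
  have h20 : m₂ 0 0 = n := by rw [hL.1, h.card]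
  have h11 : m₂ 11 = m 11 := by
    rw [hm₂, den_apply (by decide), f1 11 (by norm_num) (by norm_num)]
  have H := den_loop (i := 20) (P := .ite (.sub (.get 6 (rd 20)) (rd 11))
    (.set 11 (.const 0) (.get 6 (rd 20))) .skip) (m := m₂)
    (fun j m' => m 11 0 ≤ m' 11 0 ∧ (∀ v : Fin n, (v : ℕ) < j → m₂ 6 v ≤ m' 11 0) ∧
      (m' 11 0 = m 11 0 ∨ ∃ v : Fin n, m' 11 0 = m₂ 6 v)) ?_ ?_
  · refine ⟨fun v => m₂ 6 v, hL.2.2.2, H.1, fun v => H.2.1 v (by rw [h20]; exact v.2), H.2.2⟩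
  · simp [write, h11]
  · intro j hj m' hm' hmj ⟨h1, h2, h3⟩
    rw [h20] at hj
    have e6 : m' 6 = m₂ 6 := hm' 6 (by decide)
    have aux : ∀ v : Fin n, (v : ℕ) < j + 1 → v = ⟨j, hj⟩ ∨ (v : ℕ) < j := by
      intro v hv
      rcases Nat.lt_succ_iff_lt_or_eq.1 hv with h4 | h4
      exacts [Or.inr h4, Or.inl (Fin.ext h4)]
    have hev : Expr.eval m' (.sub (.get 6 (rd 20)) (rd 11)) = m₂ 6 j - m' 11 0 := by
      simp [Expr.eval, e6, hmj]
    rw [write_of_ne (by norm_num)]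
    by_cases hlt : m' 11 0 < m₂ 6 j
    · have e2 : (FProg.set 11 (.const 0) (.get 6 (rd 20))).den m' = write m' 11 0 (m₂ 6 j) := by
        simp [den, Expr.eval, e6, hmj]
      rw [den_ite_pos (by rw [hev]; omega), e2, write_same]
      refine ⟨by omega, fun v hv => ?_, Or.inr ⟨⟨j, hj⟩, rfl⟩⟩
      rcases aux v hv with rfl | h4
      · exact le_rfl
      · have := h2 v h4
        omega
    · rw [den_ite_neg (by rw [hev]; omega), den]
      refine ⟨h1, fun v hv => ?_, h3⟩
      rcases aux v hv with rfl | h4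
      · simp only; omega
      · exact h2 v h4

/-- The whole block of n cells is overwritten, so remnants of sets popped earlier do no harm. -/
theorem pushProg_spec {m : Mem} (h0 : m 0 0 = n) (w : Fin n) (hw : m 20 0 = w) :
    pushProg.den m 2 0 = m 2 0 + 1 ∧ (∀ c < m 2 0 * n, pushProg.den m 3 c = m 3 c) ∧
      supp n (pushProg.den m 3) (m 2 0 * n) = insert w (supp n (m 4) 0) := by
  rw [pushProg, den, den]
  set m₁ := (FProg.loop 21 (.set 3 (.add (.mul (rd 2) (rd 0)) (rd 21)) (.get 4 (rd 21)))).den m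
    with hm₁
  have f1 : ∀ k, k ≠ 3 → k ≠ 21 → m₁ k = m k := fun k h1 h2 =>
    den_apply (by simp [mods, h1, h2]) m
  have h3 : ∀ c, m₁ 3 c = if m 2 0 * n ≤ c ∧ c < m 2 0 * n + n then m 4 (c - m 2 0 * n)
      else m 3 c := by
    intro c
    rw [hm₁, den_fill (off := m 2 0 * n) (E := fun x => m 4 x) (by norm_num), h0]
    · intro m' h'
      simp [Expr.eval, h' 2, h' 0, h0]
    · intro m' h'
      simp [Expr.eval, h' 4]
  have e1 : (FProg.set 2 (.const 0) (.add (rd 2) (.const 1))).den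
      ((FProg.set 3 (.add (.mul (rd 2) (rd 0)) (rd 20)) (.const 1)).den m₁) =
      write (write m₁ 3 (m 2 0 * n + w) 1) 2 0 (m 2 0 + 1) := by
    simp [den, Expr.eval, f1 2, f1 0, f1 20, h0, hw, write_of_ne]
  rw [e1]
  refine ⟨write_same _ _ _ _, fun c hc => ?_, ?_⟩
  · rw [write_of_ne (by norm_num)]
    simp only [write, true_and]
    rw [if_neg (by omega), h3, if_neg (by omega)]
  · ext v
    rw [mem_supp, mem_insert, mem_supp, write_of_ne (by norm_num)]
    simp only [write, true_and]
    by_cases hvw : v = w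
    · simp [hvw]
    · have : (v : ℕ) ≠ w := fun h => hvw (Fin.ext h)
      rw [if_neg (by omega), h3, if_pos (by omega)]
      simp [hvw]

/-- That each w in K yields an item preserves the covering of independent sets. That each new item
comes from K gives independence and the potential estimate. -/
theorem branchProg_spec {G : SimpleGraph (Fin n)} {m : Mem} (h : IsInput G m)
    {C K : Finset (Fin n)} (hC : C = supp n (m 4) 0) (b : Fin n) (hb : m 7 0 = b)
    (hK : ∀ w : Fin n, w ∈ K ↔ m 5 w = 0 ∧ (w = b ∨ G.Adj b w)) :
    branchProg.den m 2 0 = m 2 0 + K.card ∧ (∀ c < m 2 0 * n, branchProg.den m 3 c = m 3 c) ∧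
      (∀ w ∈ K, ∃ i, m 2 0 ≤ i ∧ i < branchProg.den m 2 0 ∧
        supp n (branchProg.den m 3) (i * n) = insert w C) ∧
      ∀ i, m 2 0 ≤ i → i < branchProg.den m 2 0 →
        ∃ w ∈ K, supp n (branchProg.den m 3) (i * n) = insert w C := by
  have h0 := h.card
  have H := den_loop (i := 20) (P := .ite (.mul (notE (.get 5 (rd 20)))
    (.add (eqE 20 7) (adjE 7 20))) pushProg .skip) (m := m)
    (fun j m' => m' 2 0 = m 2 0 + (K.filter fun w : Fin n => (w : ℕ) < j).card ∧
      (∀ c < m 2 0 * n, m' 3 c = m 3 c) ∧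
      (∀ w ∈ K, (w : ℕ) < j → ∃ i, m 2 0 ≤ i ∧ i < m' 2 0 ∧
        supp n (m' 3) (i * n) = insert w C) ∧
      ∀ i, m 2 0 ≤ i → i < m' 2 0 → ∃ w ∈ K, supp n (m' 3) (i * n) = insert w C) ?_ ?_
  · obtain ⟨h1, h2, h3, h4⟩ := H
    refine ⟨?_, h2, fun w hw => h3 w hw (by rw [h0]; exact w.2), h4⟩
    rw [branchProg, h1, h0]
    simp
  · refine ⟨by simp [write], by simp [write], by simp, fun i h1 h2 => ?_⟩
    rw [write_of_ne (by norm_num)] at h2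
    omega
  · intro j hj m' hm' hmj ⟨h1, h2, h3, h4⟩
    rw [h0] at hj
    have hag : ∀ k, k ≠ 20 → k ≠ 21 → k ≠ 3 → k ≠ 2 → m' k = m k := fun k a1 a2 a3 a4 =>
      hm' k (by simp [mods, pushProg, a1, a2, a3, a4])
    have e0 : m' 0 = m 0 := hag 0 (by decide) (by decide) (by decide) (by decide)
    have e1 : m' 1 = m 1 := hag 1 (by decide) (by decide) (by decide) (by decide)
    have e4 : m' 4 = m 4 := hag 4 (by decide) (by decide) (by decide) (by decide)
    have e5 : m' 5 = m 5 := hag 5 (by decide) (by decide) (by decide) (by decide)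
    have e7 : m' 7 = m 7 := hag 7 (by decide) (by decide) (by decide) (by decide)
    have hev : Expr.eval m' (.mul (notE (.get 5 (rd 20))) (.add (eqE 20 7) (adjE 7 20))) ≠ 0 ↔
        (⟨j, hj⟩ : Fin n) ∈ K := by
      rw [hK]
      have h5 := h.adj b ⟨j, hj⟩
      have h6 : (⟨j, hj⟩ : Fin n) = b ↔ j = b := Fin.ext_iff
      rw [h6, ← h5]
      simp only [Expr.eval, e0, e1, e5, e7, hmj, hb, h0, mul_ne_zero_iff]
      refine and_congr ?_ ?_ <;> omega
    rw [write_of_ne (by norm_num), write_of_ne (by norm_num)]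
    by_cases hjK : (⟨j, hj⟩ : Fin n) ∈ K
    · rw [den_ite_pos (hev.2 hjK)]
      obtain ⟨p1, p2, p3⟩ := pushProg_spec (m := m') (n := n) (by rw [e0, h0]) ⟨j, hj⟩ hmj
      rw [e4, ← hC] at p3
      have hle : m 2 0 ≤ m' 2 0 := by omega
      have hold : ∀ i < m' 2 0, supp n (pushProg.den m' 3) (i * n) = supp n (m' 3) (i * n) := by
        intro i hi
        refine supp_congr fun v hv => p2 _ ?_
        have : (i + 1) * n ≤ m' 2 0 * n := Nat.mul_le_mul_right n hi
        rw [add_mul] at this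
        omega
      have hf : (K.filter fun w : Fin n => (w : ℕ) < j + 1) =
          insert ⟨j, hj⟩ (K.filter fun w : Fin n => (w : ℕ) < j) := by
        ext u
        simp only [mem_filter, mem_insert, Fin.ext_iff]
        constructor
        · rintro ⟨h5, h6⟩
          rcases Nat.lt_succ_iff_lt_or_eq.1 h6 with h7 | h7
          exacts [Or.inr ⟨h5, h7⟩, Or.inl h7]
        · rintro (h5 | ⟨h5, h6⟩)
          · refine ⟨?_, by omega⟩
            rw [show u = ⟨j, hj⟩ from Fin.ext h5]
            exact hjK
          · exact ⟨h5, by omega⟩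
      refine ⟨?_, fun c hc => ?_, fun w hw hwj => ?_, fun i hi hi' => ?_⟩
      · rw [p1, h1, hf, card_insert_of_notMem (by simp)]
        ring
      · rw [p2 c (hc.trans_le (Nat.mul_le_mul_right n hle)), h2 c hc]
      · rcases Nat.lt_succ_iff_lt_or_eq.1 hwj with h7 | h7
        · obtain ⟨i, h8, h9, h10⟩ := h3 w hw h7
          exact ⟨i, h8, by omega, by rw [hold i h9, h10]⟩
        · refine ⟨m' 2 0, hle, by omega, ?_⟩
          rw [p3, show w = ⟨j, hj⟩ from Fin.ext h7]
      · rw [p1] at hi'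
        rcases Nat.lt_succ_iff_lt_or_eq.1 hi' with h7 | h7
        · rw [hold i h7]
          exact h4 i hi h7
        · exact ⟨_, hjK, by rw [h7, p3]⟩
    · rw [den_ite_neg (not_ne_iff.1 (hev.not.2 hjK)), den]
      have aux : ∀ w ∈ K, (w : ℕ) < j + 1 → (w : ℕ) < j := by
        intro u hu huj
        rcases Nat.lt_succ_iff_lt_or_eq.1 huj with h5 | h5
        · exact h5
        · exact absurd hu (by rw [show u = ⟨j, hj⟩ from Fin.ext h5]; exact hjK)
      refine ⟨?_, h2, fun w hw hwj => h3 w hw (aux w hw hwj), h4⟩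
      rw [h1]
      congr 2
      refine filter_congr fun (u : Fin n) hu => ?_
      exact ⟨fun h5 => by omega, fun h5 => aux u hu h5⟩

end RAM

/-! ### The number of passes -/

section Potential

open Finset

theorem cube_le_three_pow (k : ℕ) : k ^ 3 ≤ 3 ^ k := by
  rcases lt_or_ge k 3 with h | h
  · interval_cases k <;> norm_num
  · induction k, h using Nat.le_induction with
    | base => norm_num
    | succ k hk ih =>
      rw [pow_succ 3 k]
      nlinarith [Nat.mul_le_mul hk hk, Nat.mul_le_mul (Nat.mul_le_mul hk hk) hk]

/-- Among the integers k, the root k^(1/k) is largest at k = 3; this is the source of the base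
3^(1/3). -/
theorem le_three_rpow (k : ℕ) : (k : ℝ) ≤ 3 ^ ((k : ℝ) / 3) := by
  have h1 : (k : ℝ) ^ 3 ≤ (3 ^ ((k : ℝ) / 3)) ^ 3 := by
    rw [← Real.rpow_natCast (3 ^ ((k : ℝ) / 3)) 3, ← Real.rpow_mul (by norm_num)]
    have : (k : ℝ) / 3 * (3 : ℕ) = k := by push_cast; ring
    rw [this, Real.rpow_natCast]
    exact_mod_cast cube_le_three_pow k
  exact (pow_le_pow_iff_left₀ (by positivity) (by positivity) (by norm_num)).1 h1

/-- A bound for the number of passes needed for a set with `s` vertices outside its closed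
neighbourhood. -/
noncomputable def passBound (s : ℕ) : ℝ := (s + 1) * 3 ^ ((s : ℝ) / 3)

theorem passBound_nonneg (s : ℕ) : 0 ≤ passBound s := by unfold passBound; positivity

theorem passBound_mono {s t : ℕ} (h : s ≤ t) : passBound s ≤ passBound t := by
  have h' : (s : ℝ) ≤ t := by exact_mod_cast h
  unfold passBound
  refine mul_le_mul (by linarith) ?_ (by positivity) (by positivity)
  exact Real.rpow_le_rpow_of_exponent_le (by norm_num) (by linarith)

/-- By k ≤ 3^(k/3), the k children contribute at most (s - k + 1) 3^(s/3). The factor s + 1 thus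
loses at least one copy of 3^(s/3) ≥ 1, which pays for the pass itself. -/
theorem passBound_step {s k : ℕ} (hk : 1 ≤ k) (hks : k ≤ s) :
    k * passBound (s - k) + 1 ≤ passBound s := by
  unfold passBound
  rw [Nat.cast_sub hks]
  have hk' : (1 : ℝ) ≤ k := by exact_mod_cast hk
  have hks' : (k : ℝ) ≤ s := by exact_mod_cast hks
  have h1 : (3 : ℝ) ^ ((s : ℝ) / 3) = 3 ^ ((k : ℝ) / 3) * 3 ^ (((s : ℝ) - k) / 3) := by
    rw [← Real.rpow_add (by norm_num)]
    congr 1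
    ring
  have h2 : (k : ℝ) * 3 ^ (((s : ℝ) - k) / 3) ≤ 3 ^ ((s : ℝ) / 3) := by
    rw [h1]
    exact mul_le_mul_of_nonneg_right (le_three_rpow k) (by positivity)
  have h3 : (1 : ℝ) ≤ 3 ^ ((s : ℝ) / 3) := Real.one_le_rpow (by norm_num) (by positivity)
  have h4 : (k : ℝ) * (((s : ℝ) - k + 1) * 3 ^ (((s : ℝ) - k) / 3)) ≤
      ((s : ℝ) - k + 1) * 3 ^ ((s : ℝ) / 3) := by
    calc _ = ((s : ℝ) - k + 1) * (k * 3 ^ (((s : ℝ) - k) / 3)) := by ring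
      _ ≤ _ := mul_le_mul_of_nonneg_left h2 (by linarith)
  nlinarith

variable {V : Type*} [Fintype V] [DecidableEq V]

/-- Besides w itself, all neighbours of w that were still outside disappear. -/
theorem card_outside_insert_le (G : SimpleGraph V) (C : Finset V) {w : V} (hw : w ∈ outside G C) :
    (outside G (insert w C)).card + ((outside G C ∩ nbr G {w}).card + 1) ≤ (outside G C).card := by
  have h1 : w ∉ outside G C ∩ nbr G {w} := by simp [mem_nbr]
  rw [← card_insert_of_notMem h1, ← card_union_of_disjoint]
  · refine card_le_card (union_subset (fun v hv => ?_) (insert_subset hw inter_subset_left))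
    rw [mem_outside] at hv ⊢
    exact ⟨fun h => hv.1 (mem_insert_of_mem h), fun u hu => hv.2 u (mem_insert_of_mem hu)⟩
  · rw [Finset.disjoint_left]
    intro v hv hv'
    rw [mem_outside] at hv
    simp only [mem_insert, mem_inter, mem_nbr, mem_singleton, exists_eq_left] at hv'
    rcases hv' with rfl | ⟨-, h2⟩
    · exact hv.1 (mem_insert_self _ _)
    · exact hv.2 w (mem_insert_self _ _) h2.symm

theorem isIndepSet_insert {V : Type*} [DecidableEq V] {G : SimpleGraph V} {C : Finset V}
    (hC : G.IsIndepSet (C : Set V)) {w : V} (hw : ∀ v ∈ C, ¬ G.Adj w v) : G.IsIndepSet ((insert w C : Finset V) : Set V) := by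
  rw [isIndepSet_iff] at hC ⊢
  intro x hx y hy
  rw [mem_insert] at hx hy
  rcases hx with rfl | hx <;> rcases hy with rfl | hy
  · exact G.irrefl
  · exact hw y hy
  · exact fun h => hw x hx h.symm
  · exact hC x hx y hy

theorem subset_of_outside_eq_empty {G : SimpleGraph V} {A C : Finset V} (hC : outside G C = ∅)
    (hA : G.IsIndepSet ((A ∪ C : Finset V) : Set V)) : A ⊆ C := by
  intro v hv
  by_contra hvC
  have : v ∈ outside G C := mem_outside.2 ⟨hvC, fun w hw =>
    isIndepSet_iff.1 hA v (mem_union_left _ hv) w (mem_union_right _ hw)⟩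
  simp [hC] at this

/-- An independent set that is compatible with `C` is compatible with an extension of `C` by an
element of the closed neighbourhood of any given vertex outside that of `C`. -/
theorem exists_isIndepSet_union_insert {G : SimpleGraph V} {A C : Finset V}
    (hA : G.IsIndepSet ((A ∪ C : Finset V) : Set V)) {b : V} (hb : b ∈ outside G C) :
    ∃ w ∈ outside G C, (w = b ∨ G.Adj b w) ∧
      G.IsIndepSet ((A ∪ insert w C : Finset V) : Set V) := by
  by_cases h : ∃ w ∈ A, w ∈ outside G C ∧ G.Adj b w
  · obtain ⟨w, hwA, hw, hbw⟩ := h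
    refine ⟨w, hw, Or.inr hbw, ?_⟩
    rw [union_insert, insert_eq_of_mem (mem_union_left _ hwA)]
    exact hA
  · push Not at h
    refine ⟨b, hb, Or.inl rfl, ?_⟩
    rw [union_insert]
    refine isIndepSet_insert hA fun v hv hbv => ?_
    rw [mem_union] at hv
    rw [mem_outside] at hb
    rcases hv with hv | hv
    · by_cases hvC : v ∈ C
      · exact hb.2 v hvC hbv
      · exact h v hv (mem_outside.2 ⟨hvC, fun w hw => isIndepSet_iff.1 hA v
          (mem_union_left _ hv) w (mem_union_right _ hw)⟩) hbv
    · exact hb.2 v hv hbv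

end Potential

namespace RAM

open Finset FProg

variable {n : ℕ}

/-! ### The main loop -/

/-- The set number `j` of the stack. -/
abbrev item (n : ℕ) (m : Mem) (j : ℕ) : Finset (Fin n) := supp n (m 3) (j * n)

/-- The invariant of the main loop. -/
structure IsState (G : SimpleGraph (Fin n)) (m : Mem) : Prop where
  input : IsInput G m
  isolated : m 12 0 = 0
  indep : ∀ j < m 2 0, G.IsIndepSet (item n m j : Set (Fin n))
  cover : ∀ A : Finset (Fin n), G.IsIndepSet (A : Set (Fin n)) →
    n ^ 9 * A.card ≤ m 11 0 * (nbr G A).card ∨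
      ∃ j < m 2 0, G.IsIndepSet ((A ∪ item n m j : Finset (Fin n)) : Set (Fin n))
  load : m 11 0 = 0 ∨ ∃ (C : Finset (Fin n)) (L : Fin n → ℕ) (v : Fin n),
    G.IsIndepSet (C : Set (Fin n)) ∧ IsLoad G C (n ^ 9) L ∧ m 11 0 = L v

/-- The potential of the main loop. -/
noncomputable def potential (G : SimpleGraph (Fin n)) (m : Mem) : ℝ :=
  ∑ j ∈ range (m 2 0), passBound (outside G (item n m j)).card

theorem potential_nonneg (G : SimpleGraph (Fin n)) (m : Mem) : 0 ≤ potential G m :=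
  sum_nonneg fun _ _ => passBound_nonneg _

/-- An independent set is either already bounded by the maximal load or compatible with some set on
the stack. A maximal C contains every independent set compatible with it, and its loads bound them
all. Otherwise compatibility passes to one of the children of C. -/
theorem IsState.step {G : SimpleGraph (Fin n)} {m : Mem} (h : IsState G m)
    (hG : ∀ v, ∃ w, G.Adj v w) (hsp : m 2 0 ≠ 0) :
    IsState G (bodyProg.den m) ∧ potential G (bodyProg.den m) + 1 ≤ potential G m := by
  obtain ⟨k, hk⟩ := Nat.exists_eq_succ_of_ne_zero hsp
  have hin := h.input
  have hin' : IsInput G (bodyProg.den m) :=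
    hin.congr (den_apply (by decide) _) (den_apply (by decide) _)
  have hiso' : bodyProg.den m 12 0 = 0 := by rw [den_apply (by decide), h.isolated]
  obtain ⟨p1, p2⟩ := popProg_spec hin.card
  set m₁ := popProg.den m with hm₁
  rw [hk, Nat.succ_sub_one] at p1 p2
  have hin₁ : IsInput G m₁ := hin.congr (den_apply (by decide) _) (den_apply (by decide) _)
  set C := item n m k with hC
  change supp n (m₁ 4) 0 = C at p2
  obtain ⟨q1, q2⟩ := chooseProg_spec hin₁ p2.symm
  set m₂ := chooseProg.den m₁ with hm₂
  have hin₂ : IsInput G m₂ := hin₁.congr (den_apply (by decide) _) (den_apply (by decide) _)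
  have e2 : m₂ 2 0 = k := by rw [hm₂, den_apply (by decide), p1]
  have e3 : m₂ 3 = m 3 := by rw [hm₂, den_apply (by decide), hm₁, den_apply (by decide)]
  have e4 : C = supp n (m₂ 4) 0 := by rw [hm₂, den_apply (by decide), p2]
  have e11 : m₂ 11 = m 11 := by rw [hm₂, den_apply (by decide), hm₁, den_apply (by decide)]
  have hbody : bodyProg.den m =
      (FProg.ite (.sub (rd 0) (rd 7)) branchProg leafProg).den m₂ := rfl
  have hev : Expr.eval m₂ (.sub (rd 0) (rd 7)) = n - m₂ 7 0 := by
    simp [Expr.eval, hin₂.card]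
  have hCi : G.IsIndepSet (C : Set (Fin n)) := h.indep k (by omega)
  have hpot : potential G m = ∑ j ∈ range k, passBound (outside G (item n m j)).card +
      passBound (outside G C).card := by
    rw [potential, hk, sum_range_succ]
  rcases q2 with ⟨hb, hout⟩ | ⟨b, hb, hbo, hbmin⟩
  · rw [den_ite_neg (by rw [hev, hb, Nat.sub_self])] at hbody
    obtain ⟨L, hL, hle, hLle, hmax⟩ := leafProg_spec hin₂ e4 hG
    rw [← hbody] at hle hLle hmax
    have f2 : bodyProg.den m 2 0 = k := by rw [hbody, den_apply (by decide), e2]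
    have f3 : bodyProg.den m 3 = m 3 := by rw [hbody, den_apply (by decide), e3]
    rw [e11] at hle hmax
    refine ⟨⟨hin', hiso', fun j hj => ?_, fun A hA => ?_, ?_⟩, ?_⟩
    · rw [item, f3]
      exact h.indep j (by omega)
    · rcases h.cover A hA with h1 | ⟨j, hj, hAj⟩
      · exact Or.inl (h1.trans (Nat.mul_le_mul_right _ hle))
      · rcases Nat.lt_succ_iff_lt_or_eq.1 (hj.trans_eq hk) with h2 | rfl
        · refine Or.inr ⟨j, by rw [f2]; exact h2, ?_⟩
          rw [item, f3]
          exact hAj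
        · left
          refine (hL.1 A (subset_of_outside_eq_empty hout hAj)).trans ?_
          rw [mul_comm, ← smul_eq_mul]
          exact sum_le_card_nsmul _ _ _ fun r _ => hLle r
    · rcases hmax with h1 | ⟨v, hv⟩
      · rw [h1]
        exact h.load
      · exact Or.inr ⟨C, L, v, hCi, hL, hv⟩
    · rw [hpot, potential, f2]
      simp only [item, f3, hout, card_empty]
      -- A maximal set has potential exactly 1, the price of the pass that removes it.
      have : passBound 0 = 1 := by simp [passBound]
      rw [this]
  · rw [den_ite_pos (by rw [hev, hb]; omega)] at hbody
    set K := (outside G C).filter fun w => w ∈ insert b (nbr G {b}) with hKdef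
    have hK : ∀ w : Fin n, w ∈ K ↔ m₂ 5 w = 0 ∧ (w = b ∨ G.Adj b w) := by
      intro w
      rw [hKdef, mem_filter, q1]
      simp [mem_nbr]
    have hKc : K.card = (outside G C ∩ nbr G {b}).card + 1 := by
      have h1 : b ∉ outside G C ∩ nbr G {b} := by simp [mem_nbr]
      rw [← card_insert_of_notMem h1]
      congr 1
      ext w
      simp only [hKdef, mem_filter, mem_insert, mem_inter]
      constructor
      · rintro ⟨h2, h3 | h3⟩
        exacts [Or.inl h3, Or.inr ⟨h2, h3⟩]
      · rintro (rfl | ⟨h2, h3⟩)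
        exacts [⟨hbo, Or.inl rfl⟩, ⟨h2, Or.inr h3⟩]
    have hKs : K.card ≤ (outside G C).card := card_le_card (filter_subset _ _)
    obtain ⟨r1, r2, r3, r4⟩ := branchProg_spec hin₂ e4 b hb hK
    rw [← hbody, e2] at r1 r2 r3 r4
    have f11 : bodyProg.den m 11 = m 11 := by rw [hbody, den_apply (by decide), e11]
    have hold : ∀ j < k, item n (bodyProg.den m) j = item n m j := by
      intro j hj
      refine supp_congr fun v hv => ?_
      have : (j + 1) * n ≤ k * n := Nat.mul_le_mul_right n hj
      rw [add_mul] at this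
      rw [r2 _ (by omega), e3]
    refine ⟨⟨hin', hiso', fun j hj => ?_, fun A hA => ?_, ?_⟩, ?_⟩
    · rcases lt_or_ge j k with h1 | h1
      · rw [hold j h1]
        exact h.indep j (by omega)
      · obtain ⟨w, hw, hwj⟩ := r4 j h1 hj
        rw [item, hwj]
        exact isIndepSet_insert hCi (mem_outside.1 (mem_filter.1 hw).1).2
    · rw [f11]
      rcases h.cover A hA with h1 | ⟨j, hj, hAj⟩
      · exact Or.inl h1
      · right
        rcases Nat.lt_succ_iff_lt_or_eq.1 (hj.trans_eq hk) with h2 | rfl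
        · refine ⟨j, by omega, ?_⟩
          rw [hold j h2]
          exact hAj
        · obtain ⟨w, hw, hbw, hAw⟩ := exists_isIndepSet_union_insert hAj hbo
          obtain ⟨i, -, hi, hiw⟩ := r3 w ((hK w).2 ⟨(q1 w).2 hw, hbw⟩)
          refine ⟨i, hi, ?_⟩
          rw [item, hiw]
          exact hAw
    · rw [f11]
      exact h.load
    · rw [hpot, potential, r1, sum_range_add]
      have h1 : ∑ j ∈ range k, passBound (outside G (item n (bodyProg.den m) j)).card =
          ∑ j ∈ range k, passBound (outside G (item n m j)).card :=
        sum_congr rfl fun j hj => by rw [hold j (mem_range.1 hj)]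
      -- Since b has minimum degree, inserting any w from K removes at least deg b + 1 = |K| outside
      -- vertices. So the number of children is at most the number of vertices that each child
      -- loses.
      have h2 : ∑ x ∈ range K.card,
          passBound (outside G (item n (bodyProg.den m) (k + x))).card ≤
          K.card * passBound ((outside G C).card - K.card) := by
        have h3 := sum_le_card_nsmul (range K.card)
          (fun x => passBound (outside G (item n (bodyProg.den m) (k + x))).card)
          (passBound ((outside G C).card - K.card)) ?_
        · simpa using h3
        · intro x hx
          rw [mem_range] at hx
          obtain ⟨w, hw, hwj⟩ := r4 (k + x) (by omega) (by omega)
          have hwo := (mem_filter.1 hw).1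
          refine passBound_mono ?_
          rw [item, hwj]
          have h4 := card_outside_insert_le G C hwo
          have h5 := hbmin w hwo
          omega
      have h3 := passBound_step (s := (outside G C).card) (k := K.card) (by omega) hKs
      rw [h1]
      linarith

/-! ### The first and the last part of the program -/

theorem input_isInput (G : SimpleGraph (Fin n)) : IsInput G (input G) := by
  refine ⟨by simp [input], fun i j => ?_⟩
  -- Row and column are the quotient and the remainder of the cell index modulo n.
  have h1 : (∃ i' j' : Fin n, G.Adj i' j' ∧ (i : ℕ) * n + j = i' * n + j') ↔ G.Adj i j := by
    constructor
    · rintro ⟨i', j', h, he⟩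
      have hn : 0 < n := i.pos
      have h2 : (i : ℕ) = i' := by
        have := congrArg (· / n) he
        simpa [Nat.mul_add_div, mul_comm, hn, Nat.div_eq_of_lt] using this
      have h3 : (j : ℕ) = j' := by
        rw [h2] at he
        omega
      rw [Fin.ext h2, Fin.ext h3]
      exact h
    · exact fun h => ⟨i, j, h, rfl⟩
  simp [input, h1]

theorem input_bdd (hn : 1 ≤ n) (G : SimpleGraph (Fin n)) : Bdd (input G) n := by
  intro k i
  unfold input
  split_ifs <;> omega

theorem input_apply (G : SimpleGraph (Fin n)) {k : ℕ} (hk : 2 ≤ k) (c : ℕ) :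
    input G k c = 0 := by
  unfold input
  rw [if_neg (by omega), if_neg (by omega)]

theorem startProg_spec {G : SimpleGraph (Fin n)} {m : Mem} (h : IsInput G m) :
    (startProg.den m 12 0 = 0 ↔ ∀ v, ∃ w, G.Adj v w) ∧
      startProg.den m 2 0 = 1 - startProg.den m 12 0 := by
  have h0 := h.card
  rw [startProg, den, den]
  set m₁ := (countRow 20 21 9 (adjE 20 21)).den m with hm₁
  set m₂ := (count 20 12 (.const 0) (notE (.get 9 (rd 20)))).den m₁ with hm₂
  have h10 : m₁ 0 0 = n := by rw [hm₁, den_apply (by decide), h0]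
  have hD : ∀ v : Fin n, m₁ 9 v = 0 ↔ ∀ w, ¬ G.Adj v w := by
    intro v
    rw [hm₁, den_countRow (F := fun x y => m 1 (x * n + y))
      (by norm_num) (by norm_num) (by norm_num) (by norm_num) (by norm_num) (by norm_num) ?_
      (by rw [h0]; exact v.2)]
    · rw [h0, card_filter_range, card_eq_zero, filter_eq_empty_iff]
      simp [h.adj]
    · intro m' h'
      simp [Expr.eval, h' 1, h' 0, h0]
  have h12 : m₂ 12 0 = 0 ↔ ∀ v, ∃ w, G.Adj v w := by
    rw [hm₂, den_count (A := 0) (F := fun x => 1 - m₁ 9 x) (by norm_num) (by norm_num)]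
    · rw [if_pos rfl, h10, card_filter_range, card_eq_zero, filter_eq_empty_iff]
      refine ⟨fun H v => ?_, fun H v _ hv => ?_⟩
      · have h1 := H (mem_univ v)
        by_contra h2
        push Not at h2
        rw [← hD] at h2
        rw [h2] at h1
        exact h1 (by norm_num)
      · obtain ⟨w, hw⟩ := H v
        exact (hD v).1 (by omega) w hw
    · intro m' _
      rfl
    · intro m' h'
      simp [Expr.eval, h' 9]
  have e1 : (FProg.set 2 (.const 0) (notE (rd 12))).den m₂ = write m₂ 2 0 (1 - m₂ 12 0) := rfl
  rw [e1, write_same, write_of_ne (by norm_num)]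
  exact ⟨h12, rfl⟩

theorem eval_powE {m : Mem} (h0 : m 0 0 = n) (d : ℕ) : (powE d).eval m = n ^ d := by
  induction d with
  | zero => rfl
  | succ d ih => simp [powE, Expr.eval, ih, h0, pow_succ]

/-- The fraction `p / s` is compatible with the maximal load `Λ`. -/
def Fits (n Λ p s : ℕ) : Prop :=
  1 ≤ p ∧ p ≤ n ∧ 1 ≤ s ∧ s ≤ n ∧ p * n ^ 9 ≤ Λ * (s - p)

/-- `p / s` is the maximum of the compatible fractions in `R`, or `0 / 1` if there are none. -/
def IsBest (n Λ : ℕ) (R : ℕ → ℕ → Prop) (p s : ℕ) : Prop :=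
  (∀ x y, Fits n Λ x y → R x y → x * s ≤ p * y) ∧ ((p = 0 ∧ s = 1) ∨ Fits n Λ p s)

theorem IsBest.mono {Λ p s : ℕ} {R R' : ℕ → ℕ → Prop} (h : IsBest n Λ R p s)
    (hR : ∀ x y, Fits n Λ x y → R' x y → R x y) : IsBest n Λ R' p s :=
  ⟨fun x y hxy hxy' => h.1 x y hxy (hR x y hxy hxy'), h.2⟩

theorem IsBest.pos {Λ p s : ℕ} {R : ℕ → ℕ → Prop} (h : IsBest n Λ R p s) : 0 < s := by
  rcases h.2 with h | h
  · omega
  · exact h.2.2.1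

theorem searchProg_spec {m : Mem} (h0 : m 0 0 = n) :
    IsBest n (m 11 0) (fun _ _ => True) (searchProg.den m 13 0) (searchProg.den m 14 0) := by
  rw [searchProg, den, den]
  set m₁ := (FProg.set 14 (.const 0) (.const 1)).den ((FProg.set 13 (.const 0) (.const 0)).den m)
    with hm₁
  have e1 : m₁ = write (write m 13 0 0) 14 0 1 := rfl
  set cond : Expr := .mul (.sub (.add (.mul (rd 11) (.sub (rd 21) (rd 20))) (.const 1))
        (.mul (.add (rd 20) (.const 1)) (powE 9)))
      (.sub (.mul (.add (rd 20) (.const 1)) (rd 14)) (.mul (rd 13) (.add (rd 21) (.const 1))))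
    with hcond
  set upd : FProg := .seq (.set 13 (.const 0) (.add (rd 20) (.const 1)))
        (.set 14 (.const 0) (.add (rd 21) (.const 1))) with hupd
  have h10 : m₁ 0 0 = n := by rw [hm₁, den_apply (by decide), den_apply (by decide), h0]
  have h11 : m₁ 11 = m 11 := by rw [hm₁, den_apply (by decide), den_apply (by decide)]
  have H := den_loop (i := 20) (P := .loop 21 (.ite cond upd .skip)) (m := m₁)
    (fun j m' => IsBest n (m 11 0) (fun x _ => x ≤ j) (m' 13 0) (m' 14 0)) ?_ ?_
  · exact H.mono fun x y hxy _ => hxy.2.1.trans h10.ge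
  · refine ⟨fun x y hxy hx => ?_, Or.inl ?_⟩
    · have := hxy.1
      omega
    · rw [write_of_ne (by norm_num), write_of_ne (by norm_num), e1]
      simp [write]
  · intro j hj m' hm' hmj hI
    rw [h10] at hj
    have hag : ∀ k, k ≠ 20 → k ≠ 21 → k ≠ 13 → k ≠ 14 → m' k = m₁ k := fun k a1 a2 a3 a4 =>
      hm' k (by simp [mods, hupd, a1, a2, a3, a4])
    have e00 : m' 0 0 = n := by
      rw [hag 0 (by norm_num) (by norm_num) (by norm_num) (by norm_num), h10]
    have H' := den_loop (i := 21) (P := .ite cond upd .skip) (m := m')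
      -- The candidates seen so far are all those with numerator at most j, and those with numerator
      -- j + 1 and denominator at most i.
      (fun i m'' => IsBest n (m 11 0) (fun x y => x ≤ j ∨ (x = j + 1 ∧ y ≤ i))
        (m'' 13 0) (m'' 14 0)) ?_ ?_
    · rw [write_of_ne (by norm_num), write_of_ne (by norm_num)]
      refine H'.mono fun x y hxy hx => ?_
      have := hxy.2.2.2.1
      omega
    · rw [write_of_ne (by norm_num), write_of_ne (by norm_num)]
      refine hI.mono fun x y hxy hx => ?_
      have := hxy.2.2.1
      omega
    · intro i hi m'' hm'' hmi hI'
      rw [e00] at hi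
      have hag' : ∀ k, k ≠ 21 → k ≠ 13 → k ≠ 14 → m'' k = m' k := fun k a1 a2 a3 =>
        hm'' k (by simp [mods, hupd, a1, a2, a3])
      have g0 : m'' 0 0 = n := by rw [hag' 0 (by norm_num) (by norm_num) (by norm_num), e00]
      have g11 : m'' 11 = m 11 := by
        rw [hag' 11 (by norm_num) (by norm_num) (by norm_num),
          hag 11 (by norm_num) (by norm_num) (by norm_num) (by norm_num), h11]
      have g20 : m'' 20 0 = j := by
        rw [hag' 20 (by norm_num) (by norm_num) (by norm_num), hmj]
      have hfit : Fits n (m 11 0) (j + 1) (i + 1) ↔ (j + 1) * n ^ 9 ≤ m 11 0 * (i - j) := by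
        unfold Fits
        rw [Nat.add_sub_add_right]
        exact ⟨fun h => h.2.2.2.2, fun h => ⟨by omega, by omega, by omega, by omega, h⟩⟩
      -- The counters are one less than numerator and denominator, so s - p is i - j. The added 1
      -- makes the first truncated difference nonzero also in case of equality; in the second one
      -- strictness is wanted.
      have hev : cond.eval m'' ≠ 0 ↔ Fits n (m 11 0) (j + 1) (i + 1) ∧
          m'' 13 0 * (i + 1) < (j + 1) * m'' 14 0 := by
        rw [hfit, hcond]
        simp only [Expr.eval, eval_powE g0, g11, g20, hmi, mul_ne_zero_iff]
        refine and_congr ?_ ?_ <;> omega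
      rw [write_of_ne (by norm_num), write_of_ne (by norm_num)]
      by_cases hc : Fits n (m 11 0) (j + 1) (i + 1) ∧ m'' 13 0 * (i + 1) < (j + 1) * m'' 14 0
      · have e2 : upd.den m'' = write (write m'' 13 0 (j + 1)) 14 0 (i + 1) := by
          simp [hupd, den, Expr.eval, g20, hmi, write_of_ne]
        rw [den_ite_pos (hev.2 hc), e2, write_same, write_of_ne (by norm_num), write_same]
        refine ⟨fun x y hxy hx => ?_, Or.inr hc.1⟩
        by_cases hx' : x ≤ j ∨ x = j + 1 ∧ y ≤ i
        · have h2 := hI'.1 x y hxy hx'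
          have h3 := Nat.mul_le_mul_right (i + 1) h2
          have h4 := Nat.mul_le_mul_right y hc.2.le
          -- Transitivity of the comparison of fractions, with the positive old denominator
          -- cancelled.
          refine Nat.le_of_mul_le_mul_right ?_ hI'.pos
          calc x * (i + 1) * m'' 14 0 = x * m'' 14 0 * (i + 1) := by ring
            _ ≤ m'' 13 0 * y * (i + 1) := h3
            _ = m'' 13 0 * (i + 1) * y := by ring
            _ ≤ (j + 1) * m'' 14 0 * y := h4
            _ = (j + 1) * y * m'' 14 0 := by ring
        · obtain ⟨rfl, rfl⟩ : x = j + 1 ∧ y = i + 1 := by omega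
          exact le_rfl
      · rw [den_ite_neg (not_ne_iff.1 (hev.not.2 hc)), den]
        refine ⟨fun x y hxy hx => ?_, hI'.2⟩
        by_cases hx' : x ≤ j ∨ x = j + 1 ∧ y ≤ i
        · exact hI'.1 x y hxy hx'
        · obtain ⟨rfl, rfl⟩ : x = j + 1 ∧ y = i + 1 := by omega
          by_contra hlt
          exact hc ⟨hxy, by omega⟩

theorem oneProg_den (m : Mem) : oneProg.den m = write (write m 13 0 1) 14 0 1 := rfl

theorem finalProg_spec {m : Mem} (h0 : m 0 0 = n) :
    (m 12 0 ≠ 0 → finalProg.den m 13 0 = 1 ∧ finalProg.den m 14 0 = 1) ∧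
    (m 12 0 = 0 → ∃ p s, IsBest n (m 11 0) (fun _ _ => True) p s ∧
      (s < p + p → finalProg.den m 13 0 = 1 ∧ finalProg.den m 14 0 = 1) ∧
      (p + p ≤ s → finalProg.den m 13 0 = p ∧ finalProg.den m 14 0 = s)) := by
  rw [finalProg, den, den]
  have hS := searchProg_spec h0
  set m₁ := searchProg.den m with hm₁
  set m₂ := (FProg.ite (.sub (.add (rd 13) (rd 13)) (rd 14)) oneProg .skip).den m₁ with hm₂
  have h12 : Expr.eval m₂ (rd 12) = m 12 0 := by
    have : m₂ 12 = m 12 := by rw [hm₂, den_apply (by decide), hm₁, den_apply (by decide)]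
    simp [Expr.eval, this]
  refine ⟨fun hz => ?_, fun hz => ⟨_, _, hS, fun hlt => ?_, fun hle => ?_⟩⟩
  · rw [den_ite_pos (by rw [h12]; exact hz), oneProg_den]
    simp [write]
  · rw [den_ite_neg (by rw [h12]; exact hz), den, hm₂, den_ite_pos (by simp [Expr.eval]; omega),
      oneProg_den]
    simp [write]
  · rw [den_ite_neg (by rw [h12]; exact hz), den, hm₂, den_ite_neg (by simp [Expr.eval]; omega)]
    exact ⟨rfl, rfl⟩

end RAM

/-! ### From the maximal load to the capacity -/

section Result

open Finset RAM

theorem hasTensorCapacity_of_isolated {V : Type*} [Fintype V] {G : SimpleGraph V} {v : V}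
    (hv : ∀ w, ¬ G.Adj v w) : HasTensorCapacity G 1 := by
  have h1 : nbr G {v} = ∅ := by
    rw [eq_empty_iff_forall_notMem]
    intro w hw
    obtain ⟨a, ha, haw⟩ := mem_nbr.1 hw
    rw [mem_singleton] at ha
    exact hv w (ha ▸ haw)
  refine hasTensorCapacity_one (A := {v}) ?_ (by simp [h1])
  rw [isIndepSet_iff]
  simp

/-- The maximum of `|A| / |N(A)|` is attained. -/
theorem exists_expands {V : Type*} [Fintype V] [Nonempty V] {G : SimpleGraph V}
    (hG : ∀ v, ∃ w, G.Adj v w) : ∃ A : Finset V, G.IsIndepSet (A : Set V) ∧ 0 < A.card ∧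
      0 < (nbr G A).card ∧ Expands G A.card (nbr G A).card := by
  classical
  have hpos : ∀ A : Finset V, A.Nonempty → 0 < (nbr G A).card := by
    rintro A ⟨a, ha⟩
    obtain ⟨w, hw⟩ := hG a
    exact card_pos.2 ⟨w, mem_nbr.2 ⟨a, ha, hw⟩⟩
  obtain ⟨v⟩ := ‹Nonempty V›
  have hne : ((univ : Finset (Finset V)).filter fun A : Finset V =>
      A.Nonempty ∧ G.IsIndepSet (A : Set V)).Nonempty := by
    refine ⟨{v}, mem_filter.2 ⟨mem_univ _, singleton_nonempty v, ?_⟩⟩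
    rw [isIndepSet_iff]
    simp
  obtain ⟨A, hA, hmax⟩ := exists_max_image _
    (fun A : Finset V => (A.card : ℚ) / (nbr G A).card) hne
  simp only [mem_filter, mem_univ, true_and] at hA hmax
  refine ⟨A, hA.2, card_pos.2 hA.1, hpos A hA.1, fun B hB => ?_⟩
  rcases B.eq_empty_or_nonempty with rfl | hB0
  · simp
  · have h1 := hmax B ⟨hB0, hB⟩
    rw [div_le_div_iff₀ (by exact_mod_cast hpos B hB0) (by exact_mod_cast hpos A hA.1)] at h1
    rw [mul_comm]
    exact_mod_cast h1

/-- The largest fraction that is compatible with the maximal load is the tensor capacity, unless it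
exceeds `1 / 2`. -/
theorem hasTensorCapacity_of_isBest {n Λ p s : ℕ} (hn : 1 ≤ n) {G : SimpleGraph (Fin n)}
    (hG : ∀ v, ∃ w, G.Adj v w)
    (hcov : ∀ A : Finset (Fin n), G.IsIndepSet (A : Set (Fin n)) →
      n ^ 9 * A.card ≤ Λ * (nbr G A).card)
    (hload : Λ = 0 ∨ ∃ (C : Finset (Fin n)) (L : Fin n → ℕ) (v : Fin n),
      G.IsIndepSet (C : Set (Fin n)) ∧ IsLoad G C (n ^ 9) L ∧ Λ = L v)
    (hbest : IsBest n Λ (fun _ _ => True) p s) :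
    (s < p + p → HasTensorCapacity G 1) ∧
      (p + p ≤ s → HasTensorCapacity G ((p : ℝ) / s)) := by
  have : Nonempty (Fin n) := ⟨⟨0, hn⟩⟩
  obtain ⟨A, hA, hA0, hN0, hE⟩ := exists_expands hG
  set a := A.card with ha
  set b := (nbr G A).card with hb
  have hab : a + b ≤ n := by
    rw [ha, hb, ← card_union_of_disjoint (disjoint_nbr hA)]
    exact (card_le_univ _).trans_eq (Fintype.card_fin n)
  -- The true optimum is itself a candidate, so the search returns a fraction at least as large.
  have hfit : Fits n Λ a (a + b) := by
    refine ⟨by omega, by omega, by omega, hab, ?_⟩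
    rw [Nat.add_sub_cancel_left, mul_comm]
    exact hcov A hA
  have h1 : a * s ≤ p * (a + b) := hbest.1 a (a + b) hfit trivial
  have hs := hbest.pos
  have hp : 0 < p := by
    rcases Nat.eq_zero_or_pos p with h | h
    · rw [h, zero_mul] at h1
      have := Nat.mul_pos hA0 hs
      omega
    · exact h
  have hfit' : Fits n Λ p s := by
    rcases hbest.2 with h | h
    · omega
    · exact h
  obtain ⟨-, hpn, -, hsn, hps⟩ := hfit'
  have hlt : p < s := by
    by_contra hle
    rw [Nat.sub_eq_zero_of_le (by omega), mul_zero] at hps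
    have : 0 < p * n ^ 9 := by positivity
    omega
  obtain ⟨q, rfl⟩ := Nat.exists_eq_add_of_lt hlt
  rw [show p + q + 1 - p = q + 1 by omega] at hps
  -- Here q + 1 is s - p. If p / (q + 1) exceeded a / b, then `IsLoad.lt` would put the load that
  -- attains Λ below p n^9 / (q + 1), contrary to the fit of p / s.
  have h2 : p * b ≤ a * (q + 1) := by
    by_contra hcon
    rcases hload with rfl | ⟨C, L, v, hC, hL, rfl⟩
    · have : 0 < p * n ^ 9 := by positivity
      omega
    · have h3 := IsLoad.lt (G := G) (I := C) (L := L) (p := a) (q := b) (p' := p) (q' := q + 1)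
        (by rw [Fintype.card_fin]; omega) (by rw [Fintype.card_fin]; exact hL)
        (by rw [Fintype.card_fin]; omega) (by rw [Fintype.card_fin]; omega)
        (by rw [Fintype.card_fin]; omega) (fun B hB => hE B ?_) (by omega) v
      · rw [Fintype.card_fin] at h3
        omega
      · rw [isIndepSet_iff] at hC ⊢
        exact fun x hx y hy => hC x (hB hx) y (hB hy)
  have h3 : a * (q + 1) ≤ p * b := by nlinarith
  have h4 : a * (q + 1) = p * b := le_antisymm h3 h2
  refine ⟨fun h => hasTensorCapacity_one hA ?_, fun h => ?_⟩
  · rw [← ha, ← hb]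
    by_contra hcon
    have h5 : a * (q + 1) < p * b := by
      calc a * (q + 1) ≤ b * (q + 1) := Nat.mul_le_mul_right _ (by omega)
        _ < b * p := Nat.mul_lt_mul_of_pos_left (by omega) hN0
        _ = p * b := mul_comm _ _
    omega
  · have h5 : a ≤ b := by
      by_contra hcon
      have h6 : p * b < a * (q + 1) := by
        calc p * b < p * a := Nat.mul_lt_mul_of_pos_left (by omega) hp
          _ = a * p := mul_comm _ _
          _ ≤ a * (q + 1) := Nat.mul_le_mul_left _ (by omega)
      omega
    have h6 := hasTensorCapacity_of_expands hA hA0 h5 hE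
    convert h6 using 1
    rw [div_eq_div_iff (by positivity) (by positivity)]
    have h7 : p * (a + b) = a * (p + q + 1) := by nlinarith
    exact_mod_cast h7

end Result

/-! ### Assembling the program and its running time -/

namespace RAM

open Finset FProg

theorem isState_start {n : ℕ} (G : SimpleGraph (Fin n)) (hG : ∀ v, ∃ w, G.Adj v w) :
    IsState G (startProg.den (input G)) ∧
      potential G (startProg.den (input G)) ≤ passBound n := by
  obtain ⟨h1, h2⟩ := startProg_spec (input_isInput G)
  have h12 := h1.2 hG
  have h3 : startProg.den (input G) 3 = input G 3 := den_apply (by decide) _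
  have h11 : startProg.den (input G) 11 0 = 0 := by
    rw [den_apply (by decide), input_apply G (by norm_num)]
  rw [h12] at h2
  have hitem : ∀ j, item n (startProg.den (input G)) j = ∅ := by
    intro j
    rw [eq_empty_iff_forall_notMem]
    intro v hv
    rw [mem_supp, h3, input_apply G (by norm_num)] at hv
    exact hv rfl
  refine ⟨⟨(input_isInput G).congr (den_apply (by decide) _) (den_apply (by decide) _), h12,
    fun j _ => ?_, fun A hA => Or.inr ⟨0, by omega, ?_⟩, Or.inl h11⟩, ?_⟩
  · rw [hitem, isIndepSet_iff]
    simp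
  · rw [hitem, union_empty]
    exact hA
  · rw [potential, h2]
    simp only [Nat.sub_zero, range_one, sum_singleton]
    exact passBound_mono ((card_le_univ _).trans_eq (Fintype.card_fin n))

/-- The loop turns the memory after the first part of the program into one with the empty stack
that determines the tensor capacity. -/
theorem exists_loop_inv {n : ℕ} (G : SimpleGraph (Fin n)) : ∃ (Inv : Mem → Prop) (Φ : Mem → ℝ),
    (∀ m, 0 ≤ Φ m) ∧
    (∀ m, Inv m → (rd 2).eval m ≠ 0 → Inv (bodyProg.den m) ∧ Φ (bodyProg.den m) + 1 ≤ Φ m) ∧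
    Inv (startProg.den (input G)) ∧ Φ (startProg.den (input G)) ≤ passBound n ∧
    (1 ≤ n → ∀ m, Inv m → (rd 2).eval m = 0 → 0 < finalProg.den m 14 0 ∧
      HasTensorCapacity G ((finalProg.den m 13 0 : ℝ) / (finalProg.den m 14 0 : ℝ))) := by
  by_cases hG : ∀ v, ∃ w, G.Adj v w
  · refine ⟨IsState G, potential G, potential_nonneg G, fun m hm h => hm.step hG h,
      (isState_start G hG).1, (isState_start G hG).2, fun hn m hm h => ?_⟩
    have h2 : m 2 0 = 0 := h
    obtain ⟨p, s, hps, h3, h4⟩ := (finalProg_spec hm.input.card).2 hm.isolated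
    obtain ⟨h5, h6⟩ := hasTensorCapacity_of_isBest hn hG (fun A hA => by
      rcases hm.cover A hA with h | ⟨j, hj, -⟩
      · exact h
      · omega) hm.load hps
    rcases lt_or_ge s (p + p) with h7 | h7
    · rw [(h3 h7).1, (h3 h7).2]
      simpa using h5 h7
    · rw [(h4 h7).1, (h4 h7).2]
      exact ⟨hps.pos, h6 h7⟩
  · obtain ⟨h1, h2⟩ := startProg_spec (input_isInput G)
    -- With an isolated vertex the stack starts empty, so the loop is never entered and the
    -- potential may be 0.
    refine ⟨fun m => m 0 0 = n ∧ m 12 0 ≠ 0 ∧ m 2 0 = 0, fun _ => 0, fun _ => le_rfl,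
      fun m hm h => absurd hm.2.2 h, ⟨?_, h1.not.2 hG, ?_⟩, passBound_nonneg n,
      fun _ m hm _ => ?_⟩
    · rw [den_zero wf_startProg, (input_isInput G).card]
    · have := h1.not.2 hG
      omega
    · rw [((finalProg_spec hm.1).1 hm.2.1).1, ((finalProg_spec hm.1).1 hm.2.1).2]
      push Not at hG
      obtain ⟨v, hv⟩ := hG
      simpa using hasTensorCapacity_of_isolated hv

/-- The output overwrites array 0, which programs with `wf` must not do; its cost is therefore
computed directly. -/
theorem exists_cost_output : ∃ c : ℕ, ∀ m V L, 1 ≤ L → Bdd m V → V < 2 ^ L → ∃ t,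
    Runs (.seq (.set 0 (.const 1) (rd 14)) (.set 0 (.const 0) (rd 13))) m t
      (write (write m 0 1 (m 14 0)) 0 0 (m 13 0)) ∧ t ≤ c * L ^ 2 := by
  obtain ⟨a, ha⟩ := (rd 14).exists_bound
  obtain ⟨b, hb⟩ := (rd 13).exists_bound
  refine ⟨2 * a + 2 * b + 10, fun m V L hL hm hV => ?_⟩
  have hm' : Bdd (write m 0 1 (m 14 0)) V := hm.write (hm _ _) _ _
  obtain ⟨h1, h2⟩ := ha m V L hL hm hV
  obtain ⟨h3, h4⟩ := hb _ V L hL hm' hV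
  have h5 := len_le h1
  have h6 := len_le h3
  have hLL : L ≤ L ^ 2 := Nat.le_self_pow (by norm_num) L
  have haL : a * L ≤ a * L ^ 2 := Nat.mul_le_mul_left a hLL
  have hbL : b * L ≤ b * L ^ 2 := Nat.mul_le_mul_left b hLL
  have h7 : 1 ≤ L ^ 2 := Nat.one_le_pow _ _ hL
  refine ⟨_, .seq (.set 0 (.const 1) (rd 14) m) (.set 0 (.const 0) (rd 13) _), ?_⟩
  have e1 : Expr.cost m (.const 1) = 2 := rfl
  have e2 : len (Expr.eval m (.const 1)) = 2 := by simp [len, Expr.eval]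
  have e3 : Expr.cost (write m 0 1 (m 14 0)) (.const 0) = 1 := rfl
  have e4 : len (Expr.eval (write m 0 1 (m 14 0)) (.const 0)) = 1 := rfl
  have e5 : write m 0 (Expr.eval m (.const 1)) (Expr.eval m (rd 14)) =
    write m 0 1 (m 14 0) := rfl
  rw [e5, e1, e2, e3, e4]
  have e6 : (2 * a + 2 * b + 10) * L ^ 2 = 2 * (a * L ^ 2) + 2 * (b * L ^ 2) + 10 * L ^ 2 := by
    ring
  rw [e6]
  omega

/-- Only the length of the numbers after that many passes is at stake here, so a crude exponential
bound suffices. -/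
theorem ceil_passBound_le (n : ℕ) : ⌈passBound n⌉₊ ≤ 2 ^ (3 * n) := by
  rw [Nat.ceil_le]
  have h1 : (3 : ℝ) ^ ((n : ℝ) / 3) ≤ 3 ^ (n : ℝ) :=
    Real.rpow_le_rpow_of_exponent_le (by norm_num)
      (div_le_self (Nat.cast_nonneg n) (by norm_num))
  rw [Real.rpow_natCast] at h1
  have h2 : (n : ℝ) + 1 ≤ 2 ^ n := by exact_mod_cast Nat.lt_two_pow_self (n := n)
  have h3 : (3 : ℝ) ^ n ≤ 4 ^ n := pow_le_pow_left₀ (by norm_num) (by norm_num) n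
  have h4 : (4 : ℝ) ^ n = 2 ^ (2 * n) := by rw [pow_mul]; norm_num
  unfold passBound
  calc ((n : ℝ) + 1) * 3 ^ ((n : ℝ) / 3) ≤ 2 ^ n * 2 ^ (2 * n) :=
        mul_le_mul h2 (by linarith) (by positivity) (by positivity)
    _ = ((2 ^ (3 * n) : ℕ) : ℝ) := by push_cast; rw [← pow_add]; congr 1; ring

/-- The program computes the tensor capacity in time `3 ^ (n / 3)` up to a polynomial factor. -/
theorem capacityProg_computes : ∃ a d : ℕ, ComputesTensorCapacity capacityProg
    fun n => (a : ℝ) * ((n : ℝ) + 1) ^ d * 3 ^ ((n : ℝ) / 3) := by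
  obtain ⟨K₁, hK₁, H₁⟩ := FProg.exists_cost wf_startProg
  obtain ⟨K₂, hK₂, H₂⟩ := exists_runs_loop wf_bodyProg (rd 2)
  obtain ⟨K₃, hK₃, H₃⟩ := FProg.exists_cost wf_finalProg
  obtain ⟨c, H₄⟩ := exists_cost_output
  have hL : PolyBdd fun n => n + K₁ n + K₂ n + K₃ n + 1 + n + n + n :=
    (((((PolyBdd.id.add hK₁).add hK₂).add hK₃).add (.const 1)).add .id).add .id |>.add .id
  obtain ⟨a, d, had⟩ := ((PolyBdd.id.add (.const 3)).mul
    (((hK₁.add hK₂).add hK₃).add (.const c))).mul (hL.mul hL)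
  refine ⟨a, d, fun n hn G => ?_⟩
  obtain ⟨Inv, Φ, hΦ, hstep, hstart, hΦstart, hfinal⟩ := exists_loop_inv G
  -- A common length for all numbers that occur: the three extra summands n absorb the number of
  -- passes, which is at most 2^(3n).
  set L := n + K₁ n + K₂ n + K₃ n + 1 + n + n + n with hLdef
  set N := ⌈passBound n⌉₊ with hN
  have hin : input G 0 0 = n := (input_isInput G).card
  have hbig : n + K₁ n + N * K₂ n + K₃ n < 2 ^ L := by
    have h1 : N ≤ 2 ^ (3 * n) := ceil_passBound_le n
    have h2 : 0 < 2 ^ (3 * n) := by positivity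
    have h3 : n + K₁ n + K₂ n + K₃ n < 2 ^ (n + K₁ n + K₂ n + K₃ n) := Nat.lt_two_pow_self
    have h4 : 2 ^ (3 * n) * 2 ^ (n + K₁ n + K₂ n + K₃ n) ≤ 2 ^ L := by
      rw [← pow_add]
      exact Nat.pow_le_pow_right (by norm_num) (by omega)
    have h5 : N * K₂ n ≤ 2 ^ (3 * n) * K₂ n := Nat.mul_le_mul_right _ h1
    have h6 : n + K₁ n + K₃ n ≤ 2 ^ (3 * n) * (n + K₁ n + K₃ n) := Nat.le_mul_of_pos_left _ h2
    have h7 := Nat.mul_lt_mul_of_pos_left h3 h2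
    calc n + K₁ n + N * K₂ n + K₃ n ≤ 2 ^ (3 * n) * (n + K₁ n + K₂ n + K₃ n) := by
          have : 2 ^ (3 * n) * (n + K₁ n + K₂ n + K₃ n) =
            2 ^ (3 * n) * (n + K₁ n + K₃ n) + 2 ^ (3 * n) * K₂ n := by ring
          omega
      _ < 2 ^ (3 * n) * 2 ^ (n + K₁ n + K₂ n + K₃ n) := h7
      _ ≤ 2 ^ L := h4
  obtain ⟨t₁, r₁, c₁, b₁⟩ := H₁ (input G) n L (by omega) (input_bdd hn G) (by rw [hin]; omega)
  have hn₁ : startProg.den (input G) 0 0 = n := by rw [den_zero wf_startProg, hin]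
  rw [hin] at c₁ b₁
  obtain ⟨t₂, m₂, r₂, i₂, e₂, c₂, b₂, hn₂⟩ := H₂ Inv Φ hΦ hstep N _ (n + K₁ n) L hstart
    (hΦstart.trans (Nat.le_ceil _)) (by omega) b₁ (by rw [hn₁]; omega)
  rw [hn₁] at c₂ b₂ hn₂
  obtain ⟨t₃, r₃, c₃, b₃⟩ := H₃ m₂ _ L (by omega) b₂ (by rw [hn₂]; omega)
  rw [hn₂] at c₃ b₃
  obtain ⟨t₄, r₄, c₄⟩ := H₄ (finalProg.den m₂) _ L (by omega) b₃ (by omega)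
  obtain ⟨f₁, f₂⟩ := hfinal hn m₂ i₂ e₂
  refine ⟨_, _, .seq r₁ (.seq r₂ (.seq r₃ r₄)), ?_, ?_, ?_⟩
  · have h1 : t₁ + (t₂ + (t₃ + t₄)) ≤ (N + 1) * ((K₁ n + K₂ n + K₃ n + c) * (L * L)) := by
      have h2 : (N + 1) * ((K₁ n + K₂ n + K₃ n + c) * (L * L)) = (N + 1) * K₂ n * L ^ 2 +
        N * ((K₁ n + K₃ n + c) * L ^ 2) + (K₁ n * L ^ 2 + K₃ n * L ^ 2 + c * L ^ 2) := by ring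
      rw [h2]
      omega
    -- Rounding up and the final test of the loop each cost at most one more copy of 3^(n/3) ≥ 1,
    -- whence n + 3.
    have h3 : ((N : ℝ) + 1) ≤ (n + 3) * 3 ^ ((n : ℝ) / 3) := by
      have h4 : (N : ℝ) < passBound n + 1 := Nat.ceil_lt_add_one (passBound_nonneg n)
      have h5 : (1 : ℝ) ≤ 3 ^ ((n : ℝ) / 3) := Real.one_le_rpow (by norm_num) (by positivity)
      unfold passBound at h4
      nlinarith
    have h6 : ((n : ℝ) + 3) * (((K₁ n : ℝ) + K₂ n + K₃ n + c) * ((L : ℝ) * L)) ≤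
        a * ((n : ℝ) + 1) ^ d := by
      have : (n + 3) * (K₁ n + K₂ n + K₃ n + c) * (L * L) ≤ a * (n + 1) ^ d := had n
      rw [mul_assoc] at this
      exact_mod_cast this
    have h7 : ((t₁ + (t₂ + (t₃ + t₄)) : ℕ) : ℝ) ≤
        ((N : ℝ) + 1) * (((K₁ n : ℝ) + K₂ n + K₃ n + c) * ((L : ℝ) * L)) := by exact_mod_cast h1
    calc ((t₁ + (t₂ + (t₃ + t₄)) : ℕ) : ℝ) ≤ _ := h7
      _ ≤ ((n + 3) * 3 ^ ((n : ℝ) / 3)) * (((K₁ n : ℝ) + K₂ n + K₃ n + c) * ((L : ℝ) * L)) :=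
          mul_le_mul_of_nonneg_right h3 (by positivity)
      _ = (((n : ℝ) + 3) * (((K₁ n : ℝ) + K₂ n + K₃ n + c) * ((L : ℝ) * L))) *
          3 ^ ((n : ℝ) / 3) := by ring
      _ ≤ _ := mul_le_mul_of_nonneg_right h6 (by positivity)
  · simpa [write] using f₁
  · simpa [write] using f₂

end RAM

theorem mainTheorem10 :
    ∃ (P : RAM.Prog) (T : ℕ → ℝ),
      IsOStar T (fun n => (3 : ℝ) ^ ((n : ℝ) / 3)) ∧ RAM.ComputesTensorCapacity P T := by
  obtain ⟨a, d, h⟩ := RAM.capacityProg_computes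
  -- The factor 2^d comes from n + 1 ≤ 2n.
  refine ⟨RAM.capacityProg, _, ⟨a * 2 ^ d, d, fun n hn => ?_⟩, h⟩
  refine mul_le_mul_of_nonneg_right ?_ (by positivity)
  have h1 : (1 : ℝ) ≤ n := by exact_mod_cast hn
  have h2 : ((n : ℝ) + 1) ^ d ≤ (2 * n) ^ d := pow_le_pow_left₀ (by positivity) (by linarith) d
  push_cast
  rw [mul_assoc, ← mul_pow]
  exact mul_le_mul_of_nonneg_left h2 (by positivity)
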